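/- **Theorem (Characterization of relative ergodicity for hyperfinite equivalence relations).** Let $X$ be a standard Borel space with a finite Borel measure $\mu$, let $E$ be a Borel equivalence relation on $X$ (not necessarily countable), and let $F \subseteq E$ be a $\mu$-preserving hyperfinite equivalence relation. Here *hyperfinite* means that $F=\bigcup_n F_n$ for some increasing sequence $(F_n)_n$ of Borel equivalence relations with finite classes (a *witness* to the hyperfiniteness of $F$), and *$\mu$-preserving* means that $\mu(A)=\mu(B)$ for every Borel bijection $A \to B$ between Borel sets whose graph is contained in $F$. For a finite Borel equivalence relation $F'$ (one with finite classes) and $f : X \to \mathbb{R}$, let $A_{F'}f(x) := \frac{1}{|[x]_{F'}|}\sum_{y \in [x]_{F'}} f(y)$. A function or set is *$E$-invariant modulo $\mu$-null* if its restriction to $X\setminus Z$ is invariant under $E|_{X \setminus Z}$ for some $\mu$-null Borel set $Z$ (not necessarily $E$-invariant). $F$ is *$\mu$-ergodic within $E$* if every $F$-invariant Borel set is $E$-invariant modulo $\mu$-null. A finite Borel $F' \subseteq E$ *$\varepsilon$-ties $f$ within $E$* if there is an $F'$-invariant Borel set $X' \subseteq X$ with $\mu(X \setminus X') \le \varepsilon$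 such that, for every $x \in X'$, $\sup A_{F'}f - \inf A_{F'}f < \varepsilon$, the supremum and infimum being taken over $[x]_E \cap X'$. An increasing sequence $(F_n)_n$ of finite Borel subequivalence relations of $E$ is *$f$-Cauchy within $E$* if for every $\varepsilon>0$ some $F_n$ $\varepsilon$-ties $f$ within $E$. The relation $F$ is *$f$-Cauchy within $E$* if for every $\varepsilon > 0$ every finite Borel equivalence relation $F_0 \subseteq F$ is contained in a finite Borel equivalence relation $F_1 \subseteq F$ that $\varepsilon$-ties $f$ within $E$. Let $\mathcal{D}$ be a family of bounded Borel functions $X \to \mathbb{R}$ that is dense in $L^1(X,\mu)$. Then for every $f \in \mathcal{D}$ the hyperfinite mean $A_F f := \lim_n A_{F_n} f$ exists $\mu$-a.e. for every witness $(F_n)_n$ to the hyperfiniteness of $F$, and up to a $\mu$-null set it does not depend on the witness. Moreover, the following are equivalent: 1. $F$ is $\mu$-ergodic within $E$. 2. For every $f \in \mathcal{D}$, the hyperfinite mean $A_F f$ is $E$-invariant modulo $\mu$-null. 3. For every $f \in \mathcal{D}$, every witness to the hyperfiniteness of $F$ is $f$-Cauchy within $E$. 4. For every $f \in \mathcal{D}$,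 $F$ is $f$-Cauchy within $E$. 5. For every $f \in \mathcal{D}$, some witness to the hyperfiniteness of $F$ is $f$-Cauchy within $E$. 6. There is an increasing sequence $(F_n)_n$ of finite Borel subequivalence relations of $F$ that is $f$-Cauchy within $E$ for all $f \in \mathcal{D}$. -/

import Mathlib

open MeasureTheory Filter Topology

noncomputable section

namespace RelErg

variable {X : Type*}

/-- The set `A` is invariant under the equivalence relation `F` (a union of `F`-classes). -/
def InvariantSet (F : Setoid X) (A : Set X) : Prop :=
  ∀ x y, F x y → (x ∈ A ↔ y ∈ A)

/-- The oscillation `sup f - inf f` of `f` over the set `A`, computed in the extended reals. -/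
def osc (f : X → ℝ) (A : Set X) : EReal :=
  (⨆ y ∈ A, (f y : EReal)) - ⨅ y ∈ A, (f y : EReal)

/-- For `F` with finite classes: the average of `f` over the `F`-class of `x`. -/
def finiteMean (F : Setoid X) (f : X → ℝ) (x : X) : ℝ :=
  (∑ᶠ y ∈ {y | F x y}, f y) / ({y | F x y}.ncard : ℝ)

variable [MeasurableSpace X]

/-- `E` is Borel as a subset of `X × X`. -/
def IsBorel (E : Setoid X) : Prop :=
  MeasurableSet {p : X × X | E p.1 p.2}

/-- `F` is a Borel equivalence relation all of whose classes are finite. -/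
def IsFiniteBorel (F : Setoid X) : Prop :=
  IsBorel F ∧ ∀ x, {y | F x y}.Finite

/-- `(Fn)` is an increasing sequence of finite Borel equivalence relations with union `F`. -/
def IsWitness (Fn : ℕ → Setoid X) (F : Setoid X) : Prop :=
  (∀ n, IsFiniteBorel (Fn n)) ∧ Monotone Fn ∧ ∀ x y, F x y ↔ ∃ n, Fn n x y

/-- `F` is hyperfinite. -/
def IsHyperfinite (F : Setoid X) : Prop :=
  ∃ Fn : ℕ → Setoid X, IsWitness Fn F

/-- `F` is `μ`-preserving: every partial Borel bijection `φ : A → B` between Borel sets whose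
graph is contained in `F` satisfies `μ A = μ B`. -/
def IsPreserving (F : Setoid X) (μ : Measure X) : Prop :=
  ∀ (A B : Set X) (φ : X → X), MeasurableSet A → MeasurableSet B → Measurable φ →
    Set.BijOn φ A B → (∀ x ∈ A, F x (φ x)) → μ A = μ B

open Classical in
/-- The mean of `f` over a hyperfinite `F`: the pointwise limit of the finite means of `f` along
a chosen witness to the hyperfiniteness of `F`. -/
def hyperfiniteMean (F : Setoid X) (f : X → ℝ) (x : X) : ℝ :=
  if h : IsHyperfinite F then
    limUnder atTop (fun n => finiteMean (h.choose n) f x)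
  else 0

/-- The function `g` is `E`-invariant after a `μ`-null Borel set, which need not be
`E`-invariant, is removed from `X`. -/
def AEInvariant (E : Setoid X) (μ : Measure X) (g : X → ℝ) : Prop :=
  ∃ Z : Set X, MeasurableSet Z ∧ μ Z = 0 ∧ ∀ x ∉ Z, ∀ y ∉ Z, E x y → g x = g y

/-- The set `A` is `E`-invariant after a `μ`-null Borel set, which need not be
`E`-invariant, is removed from `X`. -/
def AEInvariantSet (E : Setoid X) (μ : Measure X) (A : Set X) : Prop :=
  ∃ Z : Set X, MeasurableSet Z ∧ μ Z = 0 ∧ ∀ x ∉ Z, ∀ y ∉ Z, E x y → (x ∈ A ↔ y ∈ A)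

/-- `F` is `μ`-ergodic within `E`. -/
def ErgodicWithin (F E : Setoid X) (μ : Measure X) : Prop :=
  ∀ A : Set X, MeasurableSet A → InvariantSet F A → AEInvariantSet E μ A

/-- The finite Borel equivalence relation `F` `ε`-ties `f` within `E`. -/
def Ties (F E : Setoid X) (μ : Measure X) (f : X → ℝ) (ε : ℝ) : Prop :=
  ∃ X' : Set X, MeasurableSet X' ∧ InvariantSet F X' ∧ μ X'ᶜ ≤ ENNReal.ofReal ε ∧
    ∀ x ∈ X', osc (finiteMean F f) {y | y ∈ X' ∧ E x y} < (ε : EReal)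

/-- The increasing sequence `(Fn)` of finite Borel equivalence relations contained in `E`
is `f`-Cauchy within `E`. -/
def SeqCauchyWithin (Fn : ℕ → Setoid X) (E : Setoid X) (μ : Measure X) (f : X → ℝ) : Prop :=
  ∀ ε : ℝ, 0 < ε → ∃ n, Ties (Fn n) E μ f ε

/-- The equivalence relation `F` contained in `E` is `f`-Cauchy within `E`. -/
def CauchyWithin (F E : Setoid X) (μ : Measure X) (f : X → ℝ) : Prop :=
  ∀ ε : ℝ, 0 < ε → ∀ F₀ : Setoid X, IsFiniteBorel F₀ → F₀ ≤ F →
    ∃ F₁ : Setoid X, IsFiniteBorel F₁ ∧ F₀ ≤ F₁ ∧ F₁ ≤ F ∧ Ties F₁ E μ f ε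

end RelErg

end

/-! Averaging over a finite Borel subrelation of F is a conditional expectation: by mass transport
(`lintegral_classSum`) it preserves integrals over invariant sets. The means along a witness thus
form a reverse martingale. Their L² norms decrease, so a maximal inequality gives convergence almost
everywhere (`ae_exists_tendsto_finiteMean`). The limit has the same integral as f over every
F-invariant Borel set, which determines it and makes it independent of the witness.

The Borel input is that a finite Borel relation splits into countably many graphs of partial Borel
injections; this is derived from Novikov's separation theorem.

For the equivalences: ergodicity applied to the rational superlevel sets of the limit gives its
invariance, and convergence in measure to an invariant limit makes late finite means tie f. Any
finite Borel F₀ ≤ F starts some witness (`IsWitness.exists_isWitness_ge`), so the Cauchy property of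
all witnesses passes to F. Tying survives small L¹ perturbations (`Ties.of_integral_abs_sub_le`), so
one sequence tying a countable dense subfamily ties all of D. Conversely, the indicator of an
F-invariant set equals its own finite means. Tying a nearby function of D forces this 0-1 valued
function to be constant on E-classes within a set of nearly full measure, and Borel–Cantelli removes
the error. -/

namespace RelErg

/-! ### Novikov separation of analytic sets -/

/-- A branch through a tree of finite sequences of naturals without dead ends, the tree being
given by a property of infinite sequences that only depends on their first `k` terms. -/
theorem exists_branch {P : ℕ → (ℕ → ℕ) → Prop} (h0 : P 0 0)
    (step : ∀ k z, P k z → ∃ m, P (k + 1) (Function.update z k m))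
    (hP : ∀ k z z', (∀ i < k, z i = z' i) → P k z → P k z') : ∃ z, ∀ k, P k z := by
  have step' : ∀ k z, ∃ m, P k z → P (k + 1) (Function.update z k m) := fun k z => by
    by_cases h : P k z
    · obtain ⟨m, hm⟩ := step k z h
      exact ⟨m, fun _ => hm⟩
    · exact ⟨0, fun h' => absurd h' h⟩
  choose m hm using step'
  let p : ℕ → ℕ → ℕ := fun k => Nat.rec 0 (fun k z => Function.update z k (m k z)) k
  have p_succ : ∀ k, p (k + 1) = Function.update (p k) k (m k (p k)) := fun k => rfl
  have hp : ∀ k, P k (p k) := fun k => by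
    induction k with
    | zero => exact h0
    | succ k ih => exact hm k _ ih
  -- Coordinate i is set at stage i + 1 and never changed later, so the diagonal agrees with `p k`
  -- below k.
  refine ⟨fun i => p (i + 1) i, fun k => hP k (p k) _ (fun i hi => ?_) (hp k)⟩
  induction k, hi using Nat.le_induction with
  | base => rfl
  | succ k hk ih => rw [p_succ, Function.update_of_ne (by omega), ih]

/-- The sets `A n` are contained in measurable sets with empty intersection. -/
def MeasurablySeparableSeq {α : Type*} [MeasurableSpace α] (A : ℕ → Set α) : Prop :=
  ∃ B : ℕ → Set α, (∀ n, MeasurableSet (B n)) ∧ (∀ n, A n ⊆ B n) ∧ ⋂ n, B n = ∅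

/-- Take the union of the separators in coordinate n and their intersection elsewhere. Used
contrapositively: if A is not separable and A n is cut into countably many pieces, some piece
already gives a nonseparable sequence. -/
theorem MeasurablySeparableSeq.of_update {α : Type*} [MeasurableSpace α] {A : ℕ → Set α} (n : ℕ)
    {S : ℕ → Set α} (hS : A n ⊆ ⋃ m, S m)
    (h : ∀ m, MeasurablySeparableSeq (Function.update A n (S m))) :
    MeasurablySeparableSeq A := by
  choose B hB hAB hBe using h
  refine ⟨fun i => if i = n then ⋃ m, B m n else ⋂ m, B m i, fun i => ?_, fun i => ?_, ?_⟩
  · dsimp only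
    split_ifs
    · exact MeasurableSet.iUnion fun m => hB m n
    · exact MeasurableSet.iInter fun m => hB m i
  · dsimp only
    split_ifs with hi
    · subst hi
      refine hS.trans (Set.iUnion_mono fun m => ?_)
      simpa using hAB m i
    · refine Set.subset_iInter fun m => ?_
      simpa [hi] using hAB m i
  · refine Set.eq_empty_iff_forall_notMem.2 fun x hx => ?_
    rw [Set.mem_iInter] at hx
    have hn := hx n
    rw [if_pos rfl, Set.mem_iUnion] at hn
    obtain ⟨m, hm⟩ := hn
    have : x ∈ ⋂ i, B m i := by
      refine Set.mem_iInter.2 fun i => ?_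
      by_cases hi : i = n
      · exact hi ▸ hm
      · have := hx i
        rw [if_neg hi, Set.mem_iInter] at this
        exact this m
    rw [hBe m] at this
    exact this

/-- **Novikov's separation theorem**: analytic sets with empty intersection are contained in
Borel sets with empty intersection. -/
theorem measurablySeparableSeq_of_analyticSet {α : Type*} [TopologicalSpace α] [T2Space α]
    [MeasurableSpace α] [OpensMeasurableSpace α] {A : ℕ → Set α} (hA : ∀ n, AnalyticSet (A n))
    (hAe : ⋂ n, A n = ∅) : MeasurablySeparableSeq A := by
  by_cases hne : ∃ n, A n = ∅
  · obtain ⟨n, hn⟩ := hne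
    refine ⟨fun i => if i = n then ∅ else Set.univ, fun i => ?_, fun i => ?_, ?_⟩
    · dsimp only
      split_ifs <;> simp
    · dsimp only
      split_ifs with hi
      · rw [hi, hn]
      · exact Set.subset_univ _
    · exact Set.eq_empty_iff_forall_notMem.2 fun x hx => by simpa using Set.mem_iInter.1 hx n
  push Not at hne
  have hA' : ∀ n, ∃ f : (ℕ → ℕ) → α, Continuous f ∧ Set.range f = A n := fun n => by
    have := hA n
    rw [AnalyticSet] at this
    exact this.resolve_left (hne n).ne_empty
  choose f hf hfA using hA'
  by_contra hsep
  -- Through the pairing function, z codes one point of Baire space for every n. Stage k of the tree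
  -- fixes a single digit of a single one of these points.
  let C : ℕ → (ℕ → ℕ) → ℕ → Set (ℕ → ℕ) := fun k z n =>
    {x | ∀ j, Nat.pair n j < k → x j = z (Nat.pair n j)}
  obtain ⟨z, hz⟩ : ∃ z, ∀ k, ¬ MeasurablySeparableSeq fun n => f n '' C k z n := by
    refine exists_branch (P := fun k z => ¬ MeasurablySeparableSeq fun n => f n '' C k z n)
      ?_ ?_ ?_
    · simpa [C, hfA] using hsep
    · intro k z
      contrapose!
      intro h
      refine MeasurablySeparableSeq.of_update (Nat.unpair k).1
        (S := fun m => f (Nat.unpair k).1 ''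
          C (k + 1) (Function.update z k m) (Nat.unpair k).1) ?_ fun m => ?_
      · rintro _ ⟨x, hx, rfl⟩
        refine Set.mem_iUnion.2 ⟨x (Nat.unpair k).2, x, fun j hj => ?_, rfl⟩
        by_cases hjk : Nat.pair (Nat.unpair k).1 j = k
        · rw [hjk, Function.update_self]
          congr 1
          rw [← hjk]
          simp
        · rw [Function.update_of_ne hjk]
          exact hx j (by omega)
      · convert h m using 1
        funext n
        by_cases hn : n = (Nat.unpair k).1
        · subst hn
          simp
        · rw [Function.update_of_ne hn]
          congr 1
          ext x
          refine forall_congr' fun j => ?_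
          have hjk : Nat.pair n j ≠ k := fun h => hn (by rw [← h]; simp)
          rw [Function.update_of_ne hjk]
          have : Nat.pair n j < k ↔ Nat.pair n j < k + 1 := by omega
          rw [this]
    · intro k z z' hzz'
      have : C k z = C k z' := by
        funext n
        ext x
        refine forall_congr' fun j => ?_
        constructor <;> intro h hj
        · rw [h hj, hzz' _ hj]
        · rw [h hj, hzz' _ hj]
      rw [this]
      exact id
  let x : ℕ → ℕ → ℕ := fun n j => z (Nat.pair n j)
  -- The branch yields points of all the A n, which cannot all coincide. By continuity, disjoint
  -- neighbourhoods of two distinct ones contain the images of late cylinders, so a late stage is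
  -- separable after all.
  obtain ⟨n, n', hnn'⟩ : ∃ n n', f n (x n) ≠ f n' (x n') := by
    by_contra! h
    have : f 0 (x 0) ∈ ⋂ n, A n :=
      Set.mem_iInter.2 fun n => hfA n ▸ ⟨x n, h n 0⟩
    rw [hAe] at this
    exact this
  obtain ⟨U, V, hU, hV, hxU, hxV, hUV⟩ := t2_separation hnn'
  have small : ∀ i (W : Set α), IsOpen W → f i (x i) ∈ W → ∃ K, ∀ k ≥ K, f i '' C k z i ⊆ W := by
    intro i W hW hx
    obtain ⟨_, ⟨y, l, rfl⟩, hyl, hl⟩ := (PiNat.isTopologicalBasis_cylinders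
      (fun _ : ℕ => ℕ)).mem_nhds_iff.1 ((hf i).continuousAt.preimage_mem_nhds (hW.mem_nhds hx))
    refine ⟨Nat.pair i l, fun k hk => ?_⟩
    rintro _ ⟨y', hy', rfl⟩
    refine hl (PiNat.mem_cylinder_iff.2 fun j hj => ?_)
    rw [hy' j ((Nat.pair_lt_pair_right i hj).trans_le hk)]
    exact PiNat.mem_cylinder_iff.1 hyl j hj
  obtain ⟨K, hK⟩ := small n U hU hxU
  obtain ⟨K', hK'⟩ := small n' V hV hxV
  have hn : n ≠ n' := fun h => hnn' (h ▸ rfl)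
  refine hz (max K K') ⟨fun i => if i = n then U else if i = n' then V else Set.univ,
    fun i => ?_, fun i => ?_, ?_⟩
  · dsimp only
    split_ifs
    exacts [hU.measurableSet, hV.measurableSet, MeasurableSet.univ]
  · dsimp only
    split_ifs with h h'
    · exact h ▸ hK _ (le_max_left _ _)
    · exact h' ▸ hK' _ (le_max_right _ _)
    · exact Set.subset_univ _
  · refine Set.eq_empty_iff_forall_notMem.2 fun y hy => ?_
    rw [Set.mem_iInter] at hy
    exact Set.disjoint_left.1 hUV (by simpa using hy n) (by simpa [hn.symm] using hy n')

/-! ### Borel sets with finite sections -/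

/-- A Borel set with finite sections is a countable union of graphs of partial functions. -/
theorem exists_iUnion_injOn_fst {X Y : Type*} [MeasurableSpace X] [StandardBorelSpace X]
    [MeasurableSpace Y] [StandardBorelSpace Y] {R : Set (X × Y)} (hR : MeasurableSet R)
    (hfin : ∀ x, {y | (x, y) ∈ R}.Finite) :
    ∃ C : ℕ → Set (X × Y), (∀ n, MeasurableSet (C n)) ∧ (∀ n, Set.InjOn Prod.fst (C n)) ∧
      ⋃ n, C n = R := by
  let := upgradeStandardBorel X
  let := upgradeStandardBorel Y
  -- Adding the empty set makes the family nonempty, hence enumerable by ℕ even when Y is empty.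
  obtain ⟨U, hU⟩ : ∃ U : ℕ → Set Y, insert ∅ (TopologicalSpace.countableBasis Y) = Set.range U :=
    ((TopologicalSpace.countable_countableBasis Y).insert ∅).exists_eq_range
      (Set.insert_nonempty _ _)
  have hUo : ∀ n, MeasurableSet (U n) := fun n => by
    have : U n ∈ insert ∅ (TopologicalSpace.countableBasis Y) := hU ▸ Set.mem_range_self n
    rcases this with h | h
    · rw [h]; exact MeasurableSet.empty
    · exact (TopologicalSpace.isOpen_of_mem_countableBasis h).measurableSet
  -- The projection of `T n` consists of the (x, y) in R for which y is not the only point of its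
  -- section in `U n`. These analytic sets have empty intersection because points of a finite
  -- section are isolated. Removing Borel separators from R leaves graphs.
  let T : ℕ → Set ((X × Y) × Y) := fun n =>
    {q | q.1 ∈ R ∧ (q.1.2 ∉ U n ∨ (q.2 ∈ U n ∧ (q.1.1, q.2) ∈ R ∧ q.2 ≠ q.1.2))}
  have hT : ∀ n, MeasurableSet (T n) := fun n => by
    refine (measurable_fst hR).inter (((measurable_snd.comp measurable_fst) (hUo n)).compl.union
      ((measurable_snd (hUo n)).inter ((((measurable_fst.comp measurable_fst).prodMk
        measurable_snd) hR).inter ?_)))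
    exact (measurableSet_eq_fun measurable_snd (measurable_snd.comp measurable_fst)).compl
  obtain ⟨B, hB, hTB, hBe⟩ := measurablySeparableSeq_of_analyticSet
    (A := fun n => Prod.fst '' T n) (fun n => (hT n).analyticSet_image measurable_fst) <| by
      refine Set.eq_empty_iff_forall_notMem.2 fun p hp => ?_
      rw [Set.mem_iInter] at hp
      obtain ⟨q, hq, rfl⟩ := hp 0
      obtain ⟨V, hV, hqV, hVs⟩ := (TopologicalSpace.isBasis_countableBasis Y).exists_subset_of_mem_open
        (a := q.1.2) (u := ({y | (q.1.1, y) ∈ R} \ {q.1.2})ᶜ) (by simp)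
        ((hfin q.1.1).sdiff).isClosed.isOpen_compl
      obtain ⟨n, rfl⟩ : V ∈ Set.range U := hU ▸ Set.mem_insert_of_mem _ hV
      obtain ⟨q', hq', hqq'⟩ := hp n
      rcases hq'.2 with h | ⟨h1, h2, h3⟩
      · exact h (hqq' ▸ hqV)
      · rw [hqq'] at h2 h3
        exact hVs h1 ⟨h2, h3⟩
  refine ⟨fun n => R \ B n, fun n => hR.diff (hB n), fun n => ?_, ?_⟩
  · rintro ⟨x, y⟩ ⟨hp, hpB⟩ ⟨x', y'⟩ ⟨hp', hpB'⟩ (rfl : x = x')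
    by_contra hne
    have hyy : y' ≠ y := fun h => hne (by rw [h])
    refine hpB (hTB n ⟨((x, y), y'), ⟨hp, ?_⟩, rfl⟩)
    by_cases hy : y' ∈ U n
    · exact Or.inr ⟨hy, hp', hyy⟩
    · exact absurd (hTB n ⟨((x, y'), y'), ⟨hp', Or.inl hy⟩, rfl⟩) hpB'
  · rw [← Set.sdiff_iInter, hBe, Set.sdiff_empty]

/-! ### Class sums and mass transport -/

open scoped ENNReal

/-- The sum of `k` over the `F`-class of `x`. -/
noncomputable def classSum {X : Type*} (F : Setoid X) (k : X → ℝ≥0∞) (x : X) : ℝ≥0∞ :=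
  ∑' y : {y // F x y}, k y

/-- Since the graphs are disjoint and cover F, every point of the class of x is `φ n x` for exactly
one n with x in the domain. -/
theorem classSum_eq_tsum {X : Type*} {F : Setoid X} {C : ℕ → Set (X × X)}
    (hCd : Pairwise (Function.onFun Disjoint C)) (hCF : ⋃ n, C n = {p : X × X | F p.1 p.2})
    {φ : ℕ → X → X} (hφ : ∀ n x y, (x, y) ∈ C n ↔ x ∈ Prod.fst '' C n ∧ φ n x = y)
    (k : X → ℝ≥0∞) (x : X) :
    classSum F k x = ∑' n, (Prod.fst '' C n).indicator (k ∘ φ n) x := by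
  have hmem : ∀ n : {n | x ∈ Prod.fst '' C n}, (x, φ n x) ∈ C n := fun n =>
    (hφ n x _).2 ⟨n.2, rfl⟩
  have hF : ∀ n : {n | x ∈ Prod.fst '' C n}, F x (φ n x) := fun n => by
    have : (x, φ n x) ∈ {p : X × X | F p.1 p.2} := hCF ▸ Set.mem_iUnion.2 ⟨n, hmem n⟩
    exact this
  let e : {n | x ∈ Prod.fst '' C n} → {y // F x y} := fun n => ⟨φ n x, hF n⟩
  have he : Function.Bijective e := by
    constructor
    · intro n m hnm
      have h : φ n x = φ m x := congrArg Subtype.val hnm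
      by_contra hne
      have hne' : (n : ℕ) ≠ m := fun h' => hne (Subtype.ext h')
      exact Set.disjoint_left.1 (hCd hne') (hmem n) (h ▸ hmem m)
    · rintro ⟨y, hy⟩
      have : (x, y) ∈ ⋃ n, C n := by rw [hCF]; exact hy
      obtain ⟨n, hn⟩ := Set.mem_iUnion.1 this
      obtain ⟨h1, h2⟩ := (hφ n x y).1 hn
      exact ⟨⟨n, h1⟩, Subtype.ext h2⟩
  have h1 : classSum F k x = ∑' n : {n | x ∈ Prod.fst '' C n}, k (φ n x) :=
    ((Equiv.ofBijective e he).tsum_eq fun y : {y // F x y} => k y).symm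
  rw [h1, tsum_subtype {n | x ∈ Prod.fst '' C n} fun n => k (φ n x)]
  refine tsum_congr fun n => ?_
  by_cases hn : x ∈ Prod.fst '' C n
  · rw [Set.indicator_of_mem hn, Set.indicator_of_mem (s := {n | x ∈ Prod.fst '' C n}) hn]
    rfl
  · rw [Set.indicator_of_notMem hn, Set.indicator_of_notMem (s := {n | x ∈ Prod.fst '' C n}) hn]

section Decomposition

variable {X : Type*} [MeasurableSpace X] [StandardBorelSpace X]

/-- A finite Borel equivalence relation is a countable disjoint union of graphs of partial
Borel injections. -/
theorem IsFiniteBorel.exists_iUnion_injOn {F : Setoid X} (hF : IsFiniteBorel F) :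
    ∃ C : ℕ → Set (X × X), (∀ n, MeasurableSet (C n)) ∧ (∀ n, Set.InjOn Prod.fst (C n)) ∧
      (∀ n, Set.InjOn Prod.snd (C n)) ∧ Pairwise (Function.onFun Disjoint C) ∧
      ⋃ n, C n = {p : X × X | F p.1 p.2} := by
  obtain ⟨C, hC, hCi, hCF⟩ := exists_iUnion_injOn_fst hF.1 hF.2
  -- F is symmetric, so intersecting graphs with transposed graphs still covers F and gives
  -- injectivity in both coordinates.
  let D : ℕ → Set (X × X) := fun k =>
    C (Nat.unpair k).1 ∩ Prod.swap ⁻¹' C (Nat.unpair k).2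
  have hsub : ∀ n, disjointed D n ⊆ D n := fun n => disjointed_subset D n
  refine ⟨disjointed D, fun n => MeasurableSet.disjointed (fun k =>
      (hC _).inter (measurable_swap (hC _))) n, fun n => ?_, fun n => ?_,
      disjoint_disjointed D, ?_⟩
  · exact (hCi _).mono ((hsub n).trans Set.inter_subset_left)
  · intro p hp q hq hpq
    have := hCi _ (hsub n hp).2 (hsub n hq).2 (by simpa using hpq)
    exact Prod.swap_injective this
  · rw [iUnion_disjointed]
    ext ⟨x, y⟩
    simp only [Set.mem_iUnion]
    constructor
    · rintro ⟨k, hk, -⟩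
      rw [← hCF]
      exact Set.mem_iUnion.2 ⟨_, hk⟩
    · intro h
      have h' : ((y, x) : X × X) ∈ {p : X × X | F p.1 p.2} := F.symm h
      rw [← hCF] at h h'
      obtain ⟨n, hn⟩ := Set.mem_iUnion.1 h
      obtain ⟨m, hm⟩ := Set.mem_iUnion.1 h'
      exact ⟨Nat.pair n m, by simpa [D] using ⟨hn, hm⟩⟩

/-- A Borel set with at most one point in each section is the graph of the restriction of a
Borel function to a Borel set. -/
theorem exists_measurable_of_injOn_fst {C : Set (X × X)} (hC : MeasurableSet C)
    (hCi : Set.InjOn Prod.fst C) :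
    ∃ φ : X → X, Measurable φ ∧ ∀ x y, (x, y) ∈ C ↔ x ∈ Prod.fst '' C ∧ φ x = y := by
  classical
  -- The identity off the projection makes the function total without a base point of X.
  have hex : ∀ x, ∃ y, (x ∈ Prod.fst '' C → (x, y) ∈ C) ∧ (x ∉ Prod.fst '' C → y = x) := by
    intro x
    by_cases hx : x ∈ Prod.fst '' C
    · obtain ⟨⟨x', y⟩, h, rfl⟩ := hx
      exact ⟨y, fun _ => h, fun h' => absurd ⟨_, h, rfl⟩ h'⟩
    · exact ⟨x, fun h => absurd h hx, fun _ => rfl⟩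
  choose φ hφ hφ' using hex
  have hgraph : ∀ x y, (x, y) ∈ C ↔ x ∈ Prod.fst '' C ∧ φ x = y := by
    intro x y
    constructor
    · intro h
      have hx : x ∈ Prod.fst '' C := ⟨_, h, rfl⟩
      exact ⟨hx, congrArg Prod.snd (hCi (hφ x hx) h rfl)⟩
    · rintro ⟨hx, rfl⟩
      exact hφ x hx
  refine ⟨φ, fun S hS => ?_, hgraph⟩
  have : φ ⁻¹' S = Prod.fst '' (C ∩ Prod.snd ⁻¹' S) ∪ ((Prod.fst '' C)ᶜ ∩ S) := by
    ext x
    constructor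
    · intro hx
      by_cases h : x ∈ Prod.fst '' C
      · exact Or.inl ⟨(x, φ x), ⟨hφ x h, hx⟩, rfl⟩
      · refine Or.inr ⟨h, ?_⟩
        have : φ x ∈ S := hx
        rwa [hφ' x h] at this
    · rintro (⟨⟨x', y⟩, ⟨h, hy⟩, rfl⟩ | ⟨h, hx⟩)
      · have := ((hgraph _ _).1 h).2
        exact (this ▸ hy : φ x' ∈ S)
      · exact ((hφ' x h).symm ▸ hx : φ x ∈ S)
  rw [this]
  refine MeasurableSet.union ?_ (MeasurableSet.inter ?_ hS)
  · exact (hC.inter (measurable_snd hS)).image_of_measurable_injOn measurable_fst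
      (hCi.mono Set.inter_subset_left)
  · exact (hC.image_of_measurable_injOn measurable_fst hCi).compl

theorem measurable_classSum {F : Setoid X} (hF : IsFiniteBorel F) {k : X → ℝ≥0∞}
    (hk : Measurable k) : Measurable (classSum F k) := by
  obtain ⟨C, hC, hCf, -, hCd, hCF⟩ := hF.exists_iUnion_injOn
  choose φ hφm hφ using fun n => exists_measurable_of_injOn_fst (hC n) (hCf n)
  have : classSum F k = fun x => ∑' n, (Prod.fst '' C n).indicator (k ∘ φ n) x :=
    funext (classSum_eq_tsum hCd hCF hφ k)
  rw [this]
  exact Measurable.tsum fun n => (hk.comp (hφm n)).indicator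
    ((hC n).image_of_measurable_injOn measurable_fst (hCf n))

/-- The **mass transport principle**. -/
theorem lintegral_classSum {F : Setoid X} (hF : IsFiniteBorel F) {μ : Measure X}
    (hFμ : IsPreserving F μ) {k : X → ℝ≥0∞} (hk : Measurable k) :
    ∫⁻ x, classSum F k x ∂μ = ∫⁻ x, k x * classSum F 1 x ∂μ := by
  obtain ⟨C, hC, hCf, hCs, hCd, hCF⟩ := hF.exists_iUnion_injOn
  choose φ hφm hφ using fun n => exists_measurable_of_injOn_fst (hC n) (hCf n)
  have hA : ∀ n, MeasurableSet (Prod.fst '' C n) := fun n =>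
    (hC n).image_of_measurable_injOn measurable_fst (hCf n)
  have hB : ∀ n, MeasurableSet (Prod.snd '' C n) := fun n =>
    (hC n).image_of_measurable_injOn measurable_snd (hCs n)
  -- This is the only use of preservation: each partial injection carries the measure of its domain
  -- to that of its range.
  have hmap : ∀ n, (μ.restrict (Prod.fst '' C n)).map (φ n) = μ.restrict (Prod.snd '' C n) := by
    intro n
    ext S hS
    rw [Measure.map_apply (hφm n) hS, Measure.restrict_apply (hφm n hS),
      Measure.restrict_apply hS]
    refine hFμ _ _ (φ n) ((hφm n hS).inter (hA n)) (hS.inter (hB n)) (hφm n) ⟨?_, ?_, ?_⟩ ?_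
    · rintro x ⟨hx, hxA⟩
      exact ⟨hx, (x, φ n x), (hφ n _ _).2 ⟨hxA, rfl⟩, rfl⟩
    · rintro x ⟨-, hx⟩ y ⟨-, hy⟩ hxy
      exact congrArg Prod.fst
        (hCs n ((hφ n x _).2 ⟨hx, rfl⟩) ((hφ n y _).2 ⟨hy, rfl⟩) hxy)
    · rintro _ ⟨hy, ⟨x, y⟩, hxy, rfl⟩
      obtain ⟨h1, h2⟩ := (hφ n x y).1 hxy
      exact ⟨x, ⟨by simpa [h2] using hy, h1⟩, h2⟩
    · rintro x ⟨-, hx⟩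
      have : (x, φ n x) ∈ {p : X × X | F p.1 p.2} :=
        hCF ▸ Set.mem_iUnion.2 ⟨n, (hφ n _ _).2 ⟨hx, rfl⟩⟩
      exact this
  -- the swapped graphs decompose `F` as well
  let C' : ℕ → Set (X × X) := fun n => Prod.swap ⁻¹' C n
  have hC'i : ∀ n, Set.InjOn Prod.fst (C' n) := fun n p hp q hq h =>
    Prod.swap_injective (hCs n hp hq (by simpa using h))
  have hC'f : ∀ n, Prod.fst '' C' n = Prod.snd '' C n := fun n => by
    ext x
    constructor
    · rintro ⟨p, hp, rfl⟩
      exact ⟨p.swap, hp, rfl⟩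
    · rintro ⟨p, hp, rfl⟩
      exact ⟨p.swap, by simpa [C'] using hp, rfl⟩
  choose ψ hψm hψ using fun n => exists_measurable_of_injOn_fst (measurable_swap (hC n)) (hC'i n)
  have h1 : ∀ x, classSum F 1 x = ∑' n, (Prod.snd '' C n).indicator 1 x := fun x => by
    rw [classSum_eq_tsum (C := C') (φ := ψ) ?_ ?_ hψ]
    · simp_rw [hC'f]
      rfl
    · exact fun n m hnm => (hCd hnm).preimage _
    · rw [← Set.preimage_iUnion, hCF]
      ext p
      exact ⟨F.symm, F.symm⟩
  calc ∫⁻ x, classSum F k x ∂μ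
      = ∑' n, ∫⁻ x, (Prod.fst '' C n).indicator (k ∘ φ n) x ∂μ := by
        simp_rw [classSum_eq_tsum hCd hCF hφ k]
        exact lintegral_tsum fun n => ((hk.comp (hφm n)).indicator (hA n)).aemeasurable
    _ = ∑' n, ∫⁻ x, k x * (Prod.snd '' C n).indicator 1 x ∂μ := by
        refine tsum_congr fun n => ?_
        rw [lintegral_indicator (hA n)]
        simp only [Function.comp_def]
        rw [← lintegral_map hk (hφm n), hmap n, ← lintegral_indicator (hB n)]
        refine lintegral_congr fun x => ?_
        by_cases hx : x ∈ Prod.snd '' C n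
        · rw [Set.indicator_of_mem hx, Set.indicator_of_mem hx]; simp
        · rw [Set.indicator_of_notMem hx, Set.indicator_of_notMem hx]; simp
    _ = ∫⁻ x, k x * classSum F 1 x ∂μ := by
        simp_rw [h1, ← ENNReal.tsum_mul_left]
        exact (lintegral_tsum fun n =>
          (hk.mul (measurable_one.indicator (hB n))).aemeasurable).symm

end Decomposition

/-! ### Algebra of finite means -/

section Pointwise

variable {X : Type*} {F G : Setoid X}

theorem finiteMean_eq_sum {x : X} (hx : {y | F x y}.Finite) (f : X → ℝ) :
    finiteMean F f x = (∑ y ∈ hx.toFinset, f y) / (hx.toFinset.card : ℝ) := by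
  rw [finiteMean, finsum_mem_eq_finite_toFinset_sum f hx, Set.ncard_eq_toFinset_card _ hx]

theorem card_class_pos {x : X} (hx : {y | F x y}.Finite) : (0 : ℝ) < hx.toFinset.card := by
  rw [Nat.cast_pos, Finset.card_pos]
  exact ⟨x, by simp⟩

theorem class_eq {x x' : X} (h : F x x') : {y | F x y} = {y | F x' y} :=
  Set.ext fun _ => ⟨F.trans (F.symm h), F.trans h⟩

theorem finiteMean_congr_point {x x' : X} (h : F x x') (f : X → ℝ) :
    finiteMean F f x = finiteMean F f x' := by
  rw [finiteMean, finiteMean, class_eq h]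

theorem finiteMean_add {x : X} (hx : {y | F x y}.Finite) (f g : X → ℝ) :
    finiteMean F (fun y => f y + g y) x = finiteMean F f x + finiteMean F g x := by
  simp only [finiteMean_eq_sum hx, Finset.sum_add_distrib, add_div]

theorem finiteMean_sub {x : X} (hx : {y | F x y}.Finite) (f g : X → ℝ) :
    finiteMean F (fun y => f y - g y) x = finiteMean F f x - finiteMean F g x := by
  simp only [finiteMean_eq_sum hx, Finset.sum_sub_distrib, sub_div]

theorem finiteMean_mul_of_invariant {x : X} (hx : {y | F x y}.Finite) {h : X → ℝ}
    (hh : ∀ y z, F y z → h y = h z) (f : X → ℝ) :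
    finiteMean F (fun y => h y * f y) x = h x * finiteMean F f x := by
  rw [finiteMean_eq_sum hx, finiteMean_eq_sum hx, ← mul_div_assoc, Finset.mul_sum]
  congr 1
  refine Finset.sum_congr rfl fun y hy => ?_
  rw [hh x y (by simpa using hy)]

theorem finiteMean_const {x : X} (hx : {y | F x y}.Finite) (c : ℝ) :
    finiteMean F (fun _ => c) x = c := by
  have := card_class_pos hx
  rw [finiteMean_eq_sum hx, Finset.sum_const, nsmul_eq_mul]
  field_simp

theorem finiteMean_of_invariant {x : X} (hx : {y | F x y}.Finite) {h : X → ℝ}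
    (hh : ∀ y z, F y z → h y = h z) : finiteMean F h x = h x := by
  have := finiteMean_mul_of_invariant hx hh fun _ => 1
  simpa [finiteMean_const hx] using this

theorem finiteMean_mono {x : X} (hx : {y | F x y}.Finite) {f g : X → ℝ} (hfg : ∀ y, f y ≤ g y) :
    finiteMean F f x ≤ finiteMean F g x := by
  rw [finiteMean_eq_sum hx, finiteMean_eq_sum hx]
  gcongr with y
  exact hfg y

theorem finiteMean_nonneg {x : X} (hx : {y | F x y}.Finite) {f : X → ℝ} (hf : ∀ y, 0 ≤ f y) :
    0 ≤ finiteMean F f x := by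
  have := finiteMean_mono hx hf
  rwa [finiteMean_const hx] at this

theorem abs_finiteMean_le {x : X} (hx : {y | F x y}.Finite) (f : X → ℝ) :
    |finiteMean F f x| ≤ finiteMean F (fun y => |f y|) x := by
  rw [finiteMean_eq_sum hx, finiteMean_eq_sum hx, abs_div, Nat.abs_cast]
  gcongr
  exact Finset.abs_sum_le_sum_abs _ _

theorem abs_finiteMean_le_of_le {x : X} (hx : {y | F x y}.Finite) {f : X → ℝ} {C : ℝ}
    (hf : ∀ y, |f y| ≤ C) : |finiteMean F f x| ≤ C :=
  (abs_finiteMean_le hx f).trans ((finiteMean_mono hx hf).trans_eq (finiteMean_const hx C))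

/-- The tower property of the finite means. -/
theorem finiteMean_finiteMean (hF : ∀ x, {y | F x y}.Finite) (hFG : F ≤ G) {x : X}
    (hx : {y | G x y}.Finite) (f : X → ℝ) :
    finiteMean G (finiteMean F f) x = finiteMean G f x := by
  rw [finiteMean_eq_sum hx, finiteMean_eq_sum hx]
  congr 1
  calc ∑ y ∈ hx.toFinset, finiteMean F f y
      = ∑ y ∈ hx.toFinset, ∑ z ∈ (hF y).toFinset, f z / ((hF y).toFinset.card : ℝ) := by
        refine Finset.sum_congr rfl fun y _ => ?_
        rw [finiteMean_eq_sum (hF y), Finset.sum_div]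
    _ = ∑ z ∈ hx.toFinset, ∑ y ∈ (hF z).toFinset, f z / ((hF y).toFinset.card : ℝ) := by
        refine Finset.sum_comm' fun y z => ?_
        simp only [Set.Finite.mem_toFinset, Set.mem_ofPred_eq]
        exact ⟨fun h => ⟨F.symm h.2, G.trans h.1 (hFG h.2)⟩,
          fun h => ⟨G.trans h.2 (hFG h.1), F.symm h.1⟩⟩
    _ = ∑ z ∈ hx.toFinset, f z := by
        refine Finset.sum_congr rfl fun z _ => ?_
        have : ∀ y ∈ (hF z).toFinset, f z / ((hF y).toFinset.card : ℝ) =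
            f z / ((hF z).toFinset.card : ℝ) := fun y hy => by
          have hy' : F z y := by simpa using hy
          have : (hF y).toFinset = (hF z).toFinset := by
            rw [Set.Finite.toFinset_inj]
            exact (class_eq hy').symm
          rw [this]
        rw [Finset.sum_congr rfl this, Finset.sum_const, nsmul_eq_mul]
        have := card_class_pos (hF z)
        field_simp

theorem classSum_congr_point {x x' : X} (h : F x x') (k : X → ℝ≥0∞) :
    classSum F k x = classSum F k x' := by
  have : F x = F x' := funext fun y => propext ⟨F.trans (F.symm h), F.trans h⟩
  rw [classSum, classSum, this]

theorem classSum_eq_sum {x : X} (hx : {y | F x y}.Finite) (k : X → ℝ≥0∞) :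
    classSum F k x = ∑ y ∈ hx.toFinset, k y := by
  have : Fintype {y // F x y} := hx.fintype
  rw [classSum, tsum_fintype]
  exact (Finset.sum_subtype _ (fun y => by simp) _).symm

theorem classSum_one {x : X} (hx : {y | F x y}.Finite) :
    classSum F 1 x = hx.toFinset.card := by
  simp [classSum_eq_sum hx]

theorem ofReal_finiteMean {x : X} (hx : {y | F x y}.Finite) {f : X → ℝ} (hf : ∀ y, 0 ≤ f y) :
    ENNReal.ofReal (finiteMean F f x) =
      classSum F (fun y => ENNReal.ofReal (f y)) x / classSum F 1 x := by
  rw [finiteMean_eq_sum hx, ENNReal.ofReal_div_of_pos (card_class_pos hx),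
    ENNReal.ofReal_sum_of_nonneg fun y _ => hf y, classSum_eq_sum hx, classSum_one hx,
    ENNReal.ofReal_natCast]

end Pointwise

/-! ### Finite means as conditional expectations -/

section FiniteMean

variable {X : Type*} [MeasurableSpace X]

/-- The function `f` is Borel and bounded. -/
def BoundedMeasurable (f : X → ℝ) : Prop :=
  Measurable f ∧ ∃ C : ℝ, ∀ x, |f x| ≤ C

namespace BoundedMeasurable

variable {f g : X → ℝ}

theorem const (c : ℝ) : BoundedMeasurable fun _ : X => c :=
  ⟨measurable_const, |c|, fun _ => le_rfl⟩

theorem add (hf : BoundedMeasurable f) (hg : BoundedMeasurable g) :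
    BoundedMeasurable fun x => f x + g x := by
  obtain ⟨hf, C, hC⟩ := hf
  obtain ⟨hg, C', hC'⟩ := hg
  exact ⟨hf.add hg, C + C', fun x => (abs_add_le _ _).trans (add_le_add (hC x) (hC' x))⟩

theorem sub (hf : BoundedMeasurable f) (hg : BoundedMeasurable g) :
    BoundedMeasurable fun x => f x - g x := by
  obtain ⟨hf, C, hC⟩ := hf
  obtain ⟨hg, C', hC'⟩ := hg
  exact ⟨hf.sub hg, C + C', fun x => (abs_sub _ _).trans (add_le_add (hC x) (hC' x))⟩

theorem mul (hf : BoundedMeasurable f) (hg : BoundedMeasurable g) :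
    BoundedMeasurable fun x => f x * g x := by
  obtain ⟨hf, C, hC⟩ := hf
  obtain ⟨hg, C', hC'⟩ := hg
  refine ⟨hf.mul hg, C * C', fun x => ?_⟩
  rw [abs_mul]
  exact mul_le_mul (hC x) (hC' x) (abs_nonneg _) ((abs_nonneg _).trans (hC x))

theorem abs (hf : BoundedMeasurable f) : BoundedMeasurable fun x => |f x| := by
  obtain ⟨hf, C, hC⟩ := hf
  exact ⟨hf.abs, C, fun x => by rw [abs_abs]; exact hC x⟩

theorem indicator_one {A : Set X} (hA : MeasurableSet A) :
    BoundedMeasurable (A.indicator fun _ => (1 : ℝ)) := by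
  refine ⟨measurable_const.indicator hA, 1, fun x => ?_⟩
  by_cases hx : x ∈ A <;> simp [hx]

theorem integrable (hf : BoundedMeasurable f) (μ : Measure X) [IsFiniteMeasure μ] :
    Integrable f μ := by
  obtain ⟨hf, C, hC⟩ := hf
  exact Integrable.of_bound hf.aestronglyMeasurable C (ae_of_all _ hC)

end BoundedMeasurable

variable [StandardBorelSpace X] {F : Setoid X} {f h : X → ℝ}

theorem measurable_finiteMean_of_nonneg (hF : IsFiniteBorel F) (hf : Measurable f)
    (hf0 : ∀ x, 0 ≤ f x) : Measurable (finiteMean F f) := by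
  have : finiteMean F f = fun x =>
      (classSum F (fun y => ENNReal.ofReal (f y)) x / classSum F 1 x).toReal := by
    funext x
    rw [← ofReal_finiteMean (hF.2 x) hf0, ENNReal.toReal_ofReal (finiteMean_nonneg (hF.2 x) hf0)]
  rw [this]
  exact ((measurable_classSum hF hf.ennreal_ofReal).div
    (measurable_classSum hF measurable_one)).ennreal_toReal

theorem BoundedMeasurable.finiteMean (hf : BoundedMeasurable f) (hF : IsFiniteBorel F) :
    BoundedMeasurable (finiteMean F f) := by
  obtain ⟨hf, C, hC⟩ := hf
  refine ⟨?_, C, fun x => abs_finiteMean_le_of_le (hF.2 x) hC⟩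
  -- Adding the bound C reduces to nonnegative functions.
  have : RelErg.finiteMean F f = fun x => RelErg.finiteMean F (fun y => f y + C) x - C := by
    funext x
    rw [finiteMean_add (hF.2 x), finiteMean_const (hF.2 x), add_sub_cancel_right]
  rw [this]
  refine (measurable_finiteMean_of_nonneg hF (hf.add_const C) fun x => ?_).sub_const C
  linarith [neg_le_of_abs_le (hC x)]

variable {μ : Measure X}

/-- Mass transport in which y sends f(y)/|[y]| to each point of its class: x receives the mean, and
y sends f(y) in total. -/
theorem lintegral_finiteMean (hF : IsFiniteBorel F) (hFμ : IsPreserving F μ) (hf : Measurable f)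
    (hf0 : ∀ x, 0 ≤ f x) :
    ∫⁻ x, ENNReal.ofReal (finiteMean F f x) ∂μ = ∫⁻ x, ENNReal.ofReal (f x) ∂μ := by
  have h1 : ∀ x, ENNReal.ofReal (finiteMean F f x) =
      classSum F (fun y => ENNReal.ofReal (f y) / classSum F 1 y) x := by
    intro x
    rw [ofReal_finiteMean (hF.2 x) hf0, classSum_eq_sum (hF.2 x) fun y => ENNReal.ofReal (f y),
      classSum_eq_sum (hF.2 x) fun y => ENNReal.ofReal (f y) / classSum F 1 y,
      ENNReal.div_eq_inv_mul, Finset.mul_sum]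
    refine Finset.sum_congr rfl fun y hy => ?_
    rw [ENNReal.div_eq_inv_mul, classSum_congr_point (by simpa using hy : F x y)]
  simp_rw [h1]
  rw [lintegral_classSum hF hFμ (k := fun y => ENNReal.ofReal (f y) / classSum F 1 y)
    (hf.ennreal_ofReal.div (measurable_classSum hF measurable_one))]
  refine lintegral_congr fun x => ENNReal.div_mul_cancel ?_ ?_
  · rw [classSum_one (hF.2 x)]
    have := card_class_pos (hF.2 x)
    exact_mod_cast this.ne'
  · rw [classSum_one (hF.2 x)]
    exact ENNReal.natCast_ne_top _

variable [IsFiniteMeasure μ]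

theorem integral_finiteMean (hF : IsFiniteBorel F) (hFμ : IsPreserving F μ)
    (hf : BoundedMeasurable f) : ∫ x, finiteMean F f x ∂μ = ∫ x, f x ∂μ := by
  obtain ⟨C, hC⟩ := hf.2
  have hfC : ∀ x, 0 ≤ f x + C := fun x => by linarith [neg_le_of_abs_le (hC x)]
  have hb := hf.add (BoundedMeasurable.const C)
  have h1 : ∫ x, finiteMean F (fun y => f y + C) x ∂μ = ∫ x, f x + C ∂μ := by
    rw [integral_eq_lintegral_of_nonneg_ae (ae_of_all _ fun x => finiteMean_nonneg (hF.2 x) hfC)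
        (hb.finiteMean hF).1.aestronglyMeasurable,
      integral_eq_lintegral_of_nonneg_ae (ae_of_all _ hfC) hb.1.aestronglyMeasurable,
      lintegral_finiteMean hF hFμ hb.1 hfC]
  have h2 : ∀ x, finiteMean F (fun y => f y + C) x = finiteMean F f x + C := fun x => by
    rw [finiteMean_add (hF.2 x), finiteMean_const (hF.2 x)]
  simp_rw [h2] at h1
  rw [integral_add ((hf.finiteMean hF).integrable μ) (integrable_const C),
    integral_add (hf.integrable μ) (integrable_const C)] at h1
  exact add_right_cancel h1

/-- The defining property of conditional expectation: an invariant factor passes through the mean.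
-/
theorem integral_mul_finiteMean (hF : IsFiniteBorel F) (hFμ : IsPreserving F μ)
    (hf : BoundedMeasurable f) (hh : BoundedMeasurable h) (hhF : ∀ y z, F y z → h y = h z) :
    ∫ x, h x * finiteMean F f x ∂μ = ∫ x, h x * f x ∂μ := by
  rw [← integral_finiteMean hF hFμ (hh.mul hf)]
  exact integral_congr_ae (ae_of_all _ fun x => (finiteMean_mul_of_invariant (hF.2 x) hhF f).symm)

/-- The measure of the set where a finite mean is large is controlled by the `L¹` norm. -/
theorem measure_le_abs_finiteMean (hF : IsFiniteBorel F) (hFμ : IsPreserving F μ)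
    (hf : BoundedMeasurable f) {ε : ℝ} (hε : 0 < ε) :
    μ {x | ε ≤ |finiteMean F f x|} ≤ ENNReal.ofReal ((∫ x, |f x| ∂μ) / ε) := by
  have h1 := mul_meas_ge_le_integral_of_nonneg (μ := μ)
    (ae_of_all _ fun x => finiteMean_nonneg (hF.2 x) fun y => abs_nonneg (f y))
    ((hf.abs.finiteMean hF).integrable μ) ε
  rw [integral_finiteMean hF hFμ hf.abs] at h1
  have h2 : μ {x | ε ≤ |finiteMean F f x|} ≤ μ {x | ε ≤ finiteMean F (fun y => |f y|) x} :=
    measure_mono fun x hx => le_trans hx (abs_finiteMean_le (hF.2 x) f)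
  refine h2.trans ?_
  rw [← ENNReal.ofReal_toReal (measure_ne_top μ {x | ε ≤ finiteMean F (fun y => |f y|) x})]
  refine ENNReal.ofReal_le_ofReal ?_
  rw [le_div_iff₀ hε, mul_comm]
  exact h1

end FiniteMean

theorem IsPreserving.mono {X : Type*} [MeasurableSpace X] {F G : Setoid X} {μ : Measure X}
    (hG : IsPreserving G μ) (hFG : F ≤ G) : IsPreserving F μ :=
  fun A B φ hA hB hφ hAB hφF => hG A B φ hA hB hφ hAB fun x hx => hFG (hφF x hx)

theorem InvariantSet.indicator_eq {X : Type*} {F : Setoid X} {S : Set X} (hS : InvariantSet F S)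
    (c : ℝ) {y z : X} (h : F y z) :
    S.indicator (fun _ => c) y = S.indicator (fun _ => c) z := by
  by_cases hy : y ∈ S
  · rw [Set.indicator_of_mem hy, Set.indicator_of_mem ((hS y z h).1 hy)]
  · rw [Set.indicator_of_notMem hy, Set.indicator_of_notMem (mt (hS y z h).2 hy)]

theorem BoundedMeasurable.integral_sq_sub {X : Type*} [MeasurableSpace X] {u v : X → ℝ}
    (hu : BoundedMeasurable u) (hv : BoundedMeasurable v) (μ : Measure X) [IsFiniteMeasure μ] :
    ∫ x, (u x - v x) * (u x - v x) ∂μ =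
      (∫ x, u x * u x ∂μ) - 2 * (∫ x, v x * u x ∂μ) + ∫ x, v x * v x ∂μ := by
  have i1 := (hu.mul hu).integrable μ
  have i2 := ((hv.mul hu).integrable μ).const_mul 2
  have i3 := (hv.mul hv).integrable μ
  have i4 : Integrable (fun x => u x * u x - 2 * (v x * u x)) μ := i1.sub i2
  rw [← integral_const_mul, ← integral_sub i1 i2, ← integral_add i4 i3]
  congr 1
  funext x
  ring

/-! ### Maximal inequality, convergence and independence of the witness -/

section Convergence

variable {X : Type*} [MeasurableSpace X] [StandardBorelSpace X] {μ : Measure X}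
  [IsFiniteMeasure μ] {f : X → ℝ}

theorem setIntegral_finiteMean {F : Setoid X} (hF : IsFiniteBorel F) (hFμ : IsPreserving F μ)
    (hf : BoundedMeasurable f) {S : Set X} (hS : MeasurableSet S) (hSF : InvariantSet F S) :
    ∫ x in S, finiteMean F f x ∂μ = ∫ x in S, f x ∂μ := by
  have key := integral_mul_finiteMean hF hFμ hf (BoundedMeasurable.indicator_one hS)
    fun y z => hSF.indicator_eq 1
  have : ∀ u : X → ℝ, (∫ x, S.indicator (fun _ => (1 : ℝ)) x * u x ∂μ) = ∫ x in S, u x ∂μ := by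
    intro u
    rw [← integral_indicator hS]
    congr 1
    funext x
    by_cases hx : x ∈ S <;> simp [hx]
  rwa [this, this] at key

/-- On an invariant set the mean is orthogonal to f minus the mean, so averaging does not increase
the L² norm there; Chebyshev does the rest. -/
theorem mul_measureReal_le_setIntegral_sq {F : Setoid X} (hF : IsFiniteBorel F)
    (hFμ : IsPreserving F μ) (hf : BoundedMeasurable f) {S : Set X} (hS : MeasurableSet S)
    (hSF : InvariantSet F S) {c : ℝ} (hc : 0 ≤ c) (hcS : ∀ x ∈ S, c ≤ |finiteMean F f x|) :
    c ^ 2 * μ.real S ≤ ∫ x in S, f x * f x ∂μ := by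
  have hm := hf.finiteMean hF
  have h1 : ∫ x in S, finiteMean F f x * f x ∂μ =
      ∫ x in S, finiteMean F f x * finiteMean F f x ∂μ := by
    rw [← setIntegral_finiteMean hF hFμ (hm.mul hf) hS hSF]
    exact setIntegral_congr_fun hS fun x _ => finiteMean_mul_of_invariant (hF.2 x)
      (fun y z h => finiteMean_congr_point h f) f
  have h2 : 0 ≤ ∫ x in S, (f x - finiteMean F f x) * (f x - finiteMean F f x) ∂μ :=
    integral_nonneg fun x => mul_self_nonneg _
  have h3 : ∫ x in S, (f x - finiteMean F f x) * (f x - finiteMean F f x) ∂μ =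
      (∫ x in S, f x * f x ∂μ) - 2 * (∫ x in S, finiteMean F f x * f x ∂μ) +
        ∫ x in S, finiteMean F f x * finiteMean F f x ∂μ :=
    hf.integral_sq_sub hm _
  have h4 : c ^ 2 * μ.real S ≤ ∫ x in S, finiteMean F f x * finiteMean F f x ∂μ := by
    have : ∫ _ in S, c ^ 2 ∂μ = c ^ 2 * μ.real S := by
      rw [setIntegral_const, smul_eq_mul, mul_comm]
    rw [← this]
    refine setIntegral_mono_on (integrable_const _) ((hm.mul hm).integrable _) hS fun x hx => ?_
    rw [← abs_mul_abs_self, sq]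
    exact mul_self_le_mul_self hc (hcS x hx)
  linarith

/-- The maximal inequality for an increasing sequence of finite equivalence relations. -/
theorem mul_measureReal_exists_le {Fn : ℕ → Setoid X} (hF : ∀ n, IsFiniteBorel (Fn n))
    (hmono : Monotone Fn) (hFμ : ∀ n, IsPreserving (Fn n) μ) (hf : BoundedMeasurable f) {c : ℝ}
    (hc : 0 ≤ c) (N : ℕ) :
    c ^ 2 * μ.real {x | ∃ m ≤ N, c ≤ |finiteMean (Fn m) f x|} ≤ ∫ x, f x * f x ∂μ := by
  -- For m ≤ N, m is the last index up to N at which the mean is large. Taking the last one, not the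
  -- first, involves only relations containing `Fn m`, which makes `S m` invariant under `Fn m`.
  let S : ℕ → Set X := fun m => {x | c ≤ |finiteMean (Fn m) f x| ∧
    ∀ k, m < k → k ≤ N → |finiteMean (Fn k) f x| < c}
  have hSm : ∀ m, MeasurableSet (S m) := fun m => by
    have : S m = {x | c ≤ |finiteMean (Fn m) f x|} ∩
        ⋂ k, ⋂ (_ : m < k), ⋂ (_ : k ≤ N), {x | |finiteMean (Fn k) f x| < c} := by
      ext x; simp [S]
    rw [this]
    refine (measurableSet_le measurable_const (hf.finiteMean (hF m)).1.abs).inter ?_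
    exact MeasurableSet.iInter fun k => MeasurableSet.iInter fun _ => MeasurableSet.iInter fun _ =>
      measurableSet_lt (hf.finiteMean (hF k)).1.abs measurable_const
  have hSi : ∀ m, InvariantSet (Fn m) (S m) := fun m x y hxy => by
    have h : ∀ k, m ≤ k → finiteMean (Fn k) f x = finiteMean (Fn k) f y := fun k hk =>
      finiteMean_congr_point (hmono hk hxy) f
    refine and_congr (by rw [h m le_rfl]) (forall_congr' fun k => forall_congr' fun hk => ?_)
    rw [h k hk.le]
  have hSd : Set.PairwiseDisjoint (↑(Finset.range (N + 1)) : Set ℕ) S := by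
    have key : ∀ m k, m < k → k ≤ N → Disjoint (S m) (S k) := fun m k hmk hk =>
      Set.disjoint_left.2 fun x hx hx' => (hx.2 k hmk hk).not_ge hx'.1
    intro m hm k hk hmk
    simp only [Finset.coe_range, Set.mem_Iio] at hm hk
    rcases lt_or_gt_of_ne hmk with h | h
    · exact key m k h (by omega)
    · exact (key k m h (by omega)).symm
  have hU : {x | ∃ m ≤ N, c ≤ |finiteMean (Fn m) f x|} = ⋃ m ∈ Finset.range (N + 1), S m := by
    classical
    ext x
    simp only [Set.mem_iUnion, Finset.mem_range, exists_prop]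
    constructor
    · rintro ⟨m, hm, hx⟩
      have hfin : ({m | m ≤ N ∧ c ≤ |finiteMean (Fn m) f x|} : Set ℕ).Finite :=
        (Set.finite_Iic N).subset fun k hk => hk.1
      obtain ⟨k, hk, hmax⟩ := hfin.exists_maximalFor id _ ⟨m, hm, hx⟩
      refine ⟨k, by have := hk.1; omega, hk.2, fun l hkl hl => ?_⟩
      by_contra! h
      have : l ≤ k := hmax (j := l) ⟨hl, h⟩ hkl.le
      omega
    · rintro ⟨m, hm, hx⟩
      exact ⟨m, by omega, hx.1⟩
  have hint : Integrable (fun x => f x * f x) μ := (hf.mul hf).integrable μ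
  calc c ^ 2 * μ.real {x | ∃ m ≤ N, c ≤ |finiteMean (Fn m) f x|}
      ≤ c ^ 2 * ∑ m ∈ Finset.range (N + 1), μ.real (S m) := by
        rw [hU]
        gcongr
        exact measureReal_biUnion_finset_le _ _
    _ = ∑ m ∈ Finset.range (N + 1), c ^ 2 * μ.real (S m) := Finset.mul_sum _ _ _
    _ ≤ ∑ m ∈ Finset.range (N + 1), ∫ x in S m, f x * f x ∂μ :=
        Finset.sum_le_sum fun m _ => mul_measureReal_le_setIntegral_sq (hF m) (hFμ m) hf (hSm m)
          (hSi m) hc fun x hx => hx.1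
    _ = ∫ x in ⋃ m ∈ Finset.range (N + 1), S m, f x * f x ∂μ :=
        (integral_biUnion_finset _ (fun m _ => hSm m) hSd fun m _ => hint.integrableOn).symm
    _ ≤ ∫ x, f x * f x ∂μ :=
        setIntegral_le_integral hint (ae_of_all _ fun x => mul_self_nonneg _)

/-- Pythagoras: by the tower property, the coarser mean is orthogonal to the difference. -/
theorem integral_sq_finiteMean_sub {F G : Setoid X} (hF : IsFiniteBorel F) (hG : IsFiniteBorel G)
    (hFG : F ≤ G) (hGμ : IsPreserving G μ) (hf : BoundedMeasurable f) :
    ∫ x, (finiteMean F f x - finiteMean G f x) * (finiteMean F f x - finiteMean G f x) ∂μ =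
      (∫ x, finiteMean F f x * finiteMean F f x ∂μ) -
        ∫ x, finiteMean G f x * finiteMean G f x ∂μ := by
  have hmF := hf.finiteMean hF
  have hmG := hf.finiteMean hG
  have h1 : ∫ x, finiteMean G f x * finiteMean F f x ∂μ =
      ∫ x, finiteMean G f x * finiteMean G f x ∂μ := by
    rw [← integral_mul_finiteMean hG hGμ hmF hmG fun y z h => finiteMean_congr_point h f]
    congr 1
    funext x
    rw [finiteMean_finiteMean hF.2 hFG (hG.2 x)]
  rw [hmF.integral_sq_sub hmG, h1]
  ring

/-- The finite means along an increasing sequence of finite equivalence relations converge almost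
everywhere. -/
theorem ae_exists_tendsto_finiteMean {Fn : ℕ → Setoid X} (hF : ∀ n, IsFiniteBorel (Fn n))
    (hmono : Monotone Fn) (hFμ : ∀ n, IsPreserving (Fn n) μ) (hf : BoundedMeasurable f) :
    ∀ᵐ x ∂μ, ∃ l, Tendsto (fun n => finiteMean (Fn n) f x) atTop (𝓝 l) := by
  let a : ℕ → ℝ := fun n => ∫ x, finiteMean (Fn n) f x * finiteMean (Fn n) f x ∂μ
  have hsub : ∀ n m, n ≤ m → ∫ x, (finiteMean (Fn n) f x - finiteMean (Fn m) f x) *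
      (finiteMean (Fn n) f x - finiteMean (Fn m) f x) ∂μ = a n - a m := fun n m hnm =>
    integral_sq_finiteMean_sub (hF n) (hF m) (hmono hnm) (hFμ m) hf
  have ha : Antitone a := fun n m hnm => by
    have : 0 ≤ a n - a m := by
      rw [← hsub n m hnm]
      exact integral_nonneg fun x => mul_self_nonneg _
    linarith
  have hbdd : BddBelow (Set.range a) :=
    ⟨0, by rintro _ ⟨n, rfl⟩; exact integral_nonneg fun x => mul_self_nonneg _⟩
  have hlim := tendsto_atTop_ciInf ha hbdd
  set b := ⨅ n, a n
  have hab : ∀ n, b ≤ a n := fun n => ciInf_le hbdd n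
  -- The factor 2 ensures that, of two means at distance 2c, one lies at distance at least c from
  -- the mean at a later time N.
  let T : ℝ → ℕ → Set X := fun c n =>
    {x | ∃ m ≥ n, ∃ k ≥ n, 2 * c ≤ |finiteMean (Fn m) f x - finiteMean (Fn k) f x|}
  have hT : ∀ c, 0 < c → ∀ n, μ (T c n) ≤ ENNReal.ofReal ((a n - b) / c ^ 2) := by
    intro c hc n
    let T' : ℕ → Set X := fun N => {x | ∃ m ≥ n, m ≤ N ∧ ∃ k ≥ n, k ≤ N ∧
      2 * c ≤ |finiteMean (Fn m) f x - finiteMean (Fn k) f x|}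
    have hTT' : T c n = ⋃ N, T' N := by
      ext x
      simp only [Set.mem_iUnion]
      constructor
      · rintro ⟨m, hm, k, hk, h⟩
        exact ⟨max m k, m, hm, le_max_left _ _, k, hk, le_max_right _ _, h⟩
      · rintro ⟨N, m, hm, -, k, hk, -, h⟩
        exact ⟨m, hm, k, hk, h⟩
    have hmonoT' : Monotone T' := by
      rintro N N' hN x ⟨m, hm, hmN, k, hk, hkN, h⟩
      exact ⟨m, hm, hmN.trans hN, k, hk, hkN.trans hN, h⟩
    rw [hTT', hmonoT'.measure_iUnion]
    refine iSup_le fun N => ?_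
    by_cases hnN : n ≤ N
    swap
    · have : T' N = ∅ := Set.eq_empty_iff_forall_notMem.2 fun x hx => by
        obtain ⟨m, hm, hmN, -⟩ := hx
        omega
      rw [this]
      simp
    -- The m-th mean of h is the m-th mean of f minus the N-th, for n ≤ m ≤ N, and the squared L²
    -- norm of h is a n - a N. The maximal inequality for h therefore controls oscillation between n
    -- and N.
    let h : X → ℝ := fun x => finiteMean (Fn n) f x - finiteMean (Fn N) f x
    have hh : BoundedMeasurable h := (hf.finiteMean (hF n)).sub (hf.finiteMean (hF N))
    have hmean : ∀ m, n ≤ m → m ≤ N → ∀ x,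
        finiteMean (Fn m) h x = finiteMean (Fn m) f x - finiteMean (Fn N) f x := by
      intro m hm hmN x
      rw [finiteMean_sub ((hF m).2 x), finiteMean_finiteMean (hF n).2 (hmono hm) ((hF m).2 x),
        finiteMean_of_invariant ((hF m).2 x) fun y z hyz =>
          finiteMean_congr_point (hmono hmN hyz) f]
    have hmax := mul_measureReal_exists_le hF hmono hFμ hh hc.le N
    have hle : T' N ⊆ {x | ∃ m ≤ N, c ≤ |finiteMean (Fn m) h x|} := by
      rintro x ⟨m, hm, hmN, k, hk, hkN, hx⟩
      by_contra! hcon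
      simp only [Set.mem_ofPred_eq, not_exists, not_and, not_le] at hcon
      have h1 := hcon m hmN
      have h2 := hcon k hkN
      rw [hmean m hm hmN] at h1
      rw [hmean k hk hkN] at h2
      have h3 := abs_sub_le (finiteMean (Fn m) f x) (finiteMean (Fn N) f x) (finiteMean (Fn k) f x)
      rw [abs_sub_comm (finiteMean (Fn N) f x)] at h3
      linarith
    refine (measure_mono hle).trans ?_
    rw [← ofReal_measureReal]
    refine ENNReal.ofReal_le_ofReal ?_
    rw [le_div_iff₀ (by positivity), mul_comm]
    refine hmax.trans ?_
    rw [hsub n N hnN]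
    linarith [hab N]
  have hT0 : ∀ c, 0 < c → μ (⋂ n, T c n) = 0 := by
    intro c hc
    have h1 : Tendsto (fun n => ENNReal.ofReal ((a n - b) / c ^ 2)) atTop (𝓝 0) := by
      have : Tendsto (fun n => (a n - b) / c ^ 2) atTop (𝓝 ((b - b) / c ^ 2)) :=
        (hlim.sub_const b).div_const _
      rw [sub_self, zero_div] at this
      simpa using ENNReal.tendsto_ofReal this
    refine le_antisymm (ge_of_tendsto' h1 fun n => ?_) (zero_le)
    exact (measure_mono (Set.iInter_subset _ n)).trans (hT c hc n)
  have hae : ∀ᵐ x ∂μ, ∀ j : ℕ, x ∉ ⋂ n, T (1 / ((j : ℝ) + 1)) n :=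
    ae_all_iff.2 fun j => measure_eq_zero_iff_ae_notMem.1 (hT0 _ (by positivity))
  filter_upwards [hae] with x hx
  refine cauchySeq_tendsto_of_complete (Metric.cauchySeq_iff.2 fun ε hε => ?_)
  obtain ⟨j, hj⟩ := exists_nat_one_div_lt (half_pos hε)
  have := hx j
  rw [Set.mem_iInter] at this
  push Not at this
  obtain ⟨n, hn⟩ := this
  refine ⟨n, fun m hm k hk => ?_⟩
  by_contra! h
  refine hn ⟨m, hm, k, hk, ?_⟩
  rw [Real.dist_eq] at h
  linarith

/-- The pointwise limit of the finite means of `f` along `Fn`. -/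
noncomputable def limMean {X : Type*} (Fn : ℕ → Setoid X) (f : X → ℝ) (x : X) : ℝ :=
  limUnder atTop fun n => finiteMean (Fn n) f x

/-- The two sequences eventually agree, so this holds even where they diverge; invariance of the
limit needs no null set. -/
theorem limMean_congr_point {X : Type*} {Fn : ℕ → Setoid X} (hmono : Monotone Fn) (f : X → ℝ)
    {x y : X} (h : ∃ n, Fn n x y) : limMean Fn f x = limMean Fn f y := by
  obtain ⟨n, hn⟩ := h
  have : (fun n => finiteMean (Fn n) f x) =ᶠ[atTop] fun n => finiteMean (Fn n) f y := by
    filter_upwards [eventually_ge_atTop n] with m hm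
    exact finiteMean_congr_point (hmono hm hn) f
  rw [limMean, limMean, limUnder, limUnder, map_congr this]

theorem measurable_limMean {Fn : ℕ → Setoid X} (hF : ∀ n, IsFiniteBorel (Fn n))
    (hf : BoundedMeasurable f) : Measurable (limMean Fn f) :=
  (StronglyMeasurable.limUnder fun n => (hf.finiteMean (hF n)).1.stronglyMeasurable).measurable

variable {F : Setoid X}

theorem IsWitness.le {X : Type*} [MeasurableSpace X] {F : Setoid X} {Fn : ℕ → Setoid X}
    (h : IsWitness Fn F) (n : ℕ) : Fn n ≤ F :=
  fun {x y} hxy => (h.2.2 x y).2 ⟨n, hxy⟩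

theorem IsWitness.ae_tendsto {Fn : ℕ → Setoid X} (h : IsWitness Fn F) (hFμ : IsPreserving F μ)
    (hf : BoundedMeasurable f) :
    ∀ᵐ x ∂μ, Tendsto (fun n => finiteMean (Fn n) f x) atTop (𝓝 (limMean Fn f x)) := by
  filter_upwards [ae_exists_tendsto_finiteMean h.1 h.2.1 (fun n => hFμ.mono (h.le n)) hf] with x hx
  exact tendsto_nhds_limUnder hx

theorem IsWitness.ae_abs_limMean_le {Fn : ℕ → Setoid X} (h : IsWitness Fn F)
    (hFμ : IsPreserving F μ) (hf : BoundedMeasurable f) {C : ℝ} (hC : ∀ x, |f x| ≤ C) :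
    ∀ᵐ x ∂μ, |limMean Fn f x| ≤ C := by
  filter_upwards [h.ae_tendsto hFμ hf] with x hx
  exact le_of_tendsto' hx.abs fun n => abs_finiteMean_le_of_le ((h.1 n).2 x) hC

theorem IsWitness.integrable_limMean {Fn : ℕ → Setoid X} (h : IsWitness Fn F)
    (hFμ : IsPreserving F μ) (hf : BoundedMeasurable f) : Integrable (limMean Fn f) μ := by
  obtain ⟨C, hC⟩ := hf.2
  exact Integrable.of_bound (measurable_limMean h.1 hf).aestronglyMeasurable C
    (h.ae_abs_limMean_le hFμ hf hC)

theorem IsWitness.setIntegral_limMean {Fn : ℕ → Setoid X} (h : IsWitness Fn F)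
    (hFμ : IsPreserving F μ) (hf : BoundedMeasurable f) {S : Set X} (hS : MeasurableSet S)
    (hSF : InvariantSet F S) : ∫ x in S, limMean Fn f x ∂μ = ∫ x in S, f x ∂μ := by
  obtain ⟨C, hC⟩ := hf.2
  have h1 : Tendsto (fun n => ∫ x in S, finiteMean (Fn n) f x ∂μ) atTop
      (𝓝 (∫ x in S, limMean Fn f x ∂μ)) :=
    tendsto_integral_of_dominated_convergence (fun _ => C)
      (fun n => (hf.finiteMean (h.1 n)).1.aestronglyMeasurable) (integrable_const C)
      (fun n => ae_of_all _ fun x => abs_finiteMean_le_of_le ((h.1 n).2 x) hC)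
      (ae_restrict_of_ae (h.ae_tendsto hFμ hf))
  have h2 : ∀ n, ∫ x in S, finiteMean (Fn n) f x ∂μ = ∫ x in S, f x ∂μ := fun n =>
    setIntegral_finiteMean (h.1 n) (hFμ.mono (h.le n)) hf hS
      fun x y hxy => hSF x y (h.le n hxy)
  simp_rw [h2] at h1
  exact tendsto_nhds_unique h1 tendsto_const_nhds

/-- The set where the inequality fails is F-invariant, and over it both limits have the integral of
f; hence it is null. -/
theorem IsWitness.ae_limMean_le {Fn Gn : ℕ → Setoid X} (hFn : IsWitness Fn F)
    (hGn : IsWitness Gn F) (hFμ : IsPreserving F μ) (hf : BoundedMeasurable f) :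
    ∀ᵐ x ∂μ, limMean Fn f x ≤ limMean Gn f x := by
  let S : Set X := {x | limMean Gn f x < limMean Fn f x}
  have hS : MeasurableSet S := measurableSet_lt (measurable_limMean hGn.1 hf)
    (measurable_limMean hFn.1 hf)
  have hSF : InvariantSet F S := fun x y hxy => by
    simp only [S, Set.mem_ofPred_eq]
    rw [limMean_congr_point hFn.2.1 f ((hFn.2.2 x y).1 hxy),
      limMean_congr_point hGn.2.1 f ((hGn.2.2 x y).1 hxy)]
  have i1 := (hFn.integrable_limMean hFμ hf).integrableOn (s := S)
  have i2 := (hGn.integrable_limMean hFμ hf).integrableOn (s := S)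
  have h0 : ∫ x in S, (limMean Fn f x - limMean Gn f x) ∂μ = 0 := by
    rw [integral_sub i1 i2, hFn.setIntegral_limMean hFμ hf hS hSF,
      hGn.setIntegral_limMean hFμ hf hS hSF, sub_self]
  have h1 : ∀ᵐ x ∂μ.restrict S, (0 : ℝ) ≤ limMean Fn f x - limMean Gn f x :=
    (ae_restrict_iff' hS).2 (ae_of_all _ fun x hx => (sub_pos.2 hx).le)
  have h2 := (setIntegral_eq_zero_iff_of_nonneg_ae h1 (i1.sub i2)).1 h0
  filter_upwards [(ae_restrict_iff' hS).1 h2] with x hx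
  by_contra! hlt
  have h3 : limMean Fn f x - limMean Gn f x = 0 := hx hlt
  linarith

theorem IsWitness.ae_limMean_eq {Fn Gn : ℕ → Setoid X} (hFn : IsWitness Fn F)
    (hGn : IsWitness Gn F) (hFμ : IsPreserving F μ) (hf : BoundedMeasurable f) :
    ∀ᵐ x ∂μ, limMean Fn f x = limMean Gn f x := by
  filter_upwards [hFn.ae_limMean_le hGn hFμ hf, hGn.ae_limMean_le hFn hFμ hf] with x h1 h2
  exact le_antisymm h1 h2

theorem hyperfiniteMean_eq_limMean {X : Type*} [MeasurableSpace X] {F : Setoid X}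
    (hF : IsHyperfinite F) (f : X → ℝ) : hyperfiniteMean F f = limMean hF.choose f := by
  funext x
  rw [hyperfiniteMean, dif_pos hF, limMean]

theorem IsWitness.ae_tendsto_hyperfiniteMean {Fn : ℕ → Setoid X} (h : IsWitness Fn F)
    (hFμ : IsPreserving F μ) (hf : BoundedMeasurable f) :
    ∀ᵐ x ∂μ, Tendsto (fun n => finiteMean (Fn n) f x) atTop (𝓝 (hyperfiniteMean F f x)) := by
  have hF : IsHyperfinite F := ⟨Fn, h⟩
  rw [hyperfiniteMean_eq_limMean hF]
  filter_upwards [h.ae_tendsto hFμ hf, h.ae_limMean_eq hF.choose_spec hFμ hf] with x h1 h2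
  rwa [← h2]

theorem measurable_hyperfiniteMean (hF : IsHyperfinite F) (hf : BoundedMeasurable f) :
    Measurable (hyperfiniteMean F f) := by
  rw [hyperfiniteMean_eq_limMean hF]
  exact measurable_limMean hF.choose_spec.1 hf

theorem hyperfiniteMean_congr_point {X : Type*} [MeasurableSpace X] {F : Setoid X}
    (hF : IsHyperfinite F) (f : X → ℝ) {x y : X} (h : F x y) :
    hyperfiniteMean F f x = hyperfiniteMean F f y := by
  rw [hyperfiniteMean_eq_limMean hF]
  exact limMean_congr_point hF.choose_spec.2.1 f ((hF.choose_spec.2.2 x y).1 h)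

end Convergence

/-! ### Oscillation and tying -/

theorem osc_lt_of_abs_sub_le {X : Type*} {f : X → ℝ} {A : Set X} {c δ ε : ℝ}
    (h : ∀ y ∈ A, |f y - c| ≤ δ) (hδ : 2 * δ < ε) : osc f A < (ε : EReal) := by
  have h1 : (⨆ y ∈ A, (f y : EReal)) ≤ ((c + δ : ℝ) : EReal) :=
    iSup₂_le fun y hy => EReal.coe_le_coe_iff.2 (by linarith [(abs_le.1 (h y hy)).2])
  have h2 : ((c - δ : ℝ) : EReal) ≤ ⨅ y ∈ A, (f y : EReal) :=
    le_iInf₂ fun y hy => EReal.coe_le_coe_iff.2 (by linarith [(abs_le.1 (h y hy)).1])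
  refine (EReal.sub_le_sub h1 h2).trans_lt ?_
  rw [← EReal.coe_sub, EReal.coe_lt_coe_iff]
  linarith

theorem abs_sub_lt_of_osc_lt {X : Type*} {f : X → ℝ} {A : Set X} {ε : ℝ}
    (h : osc f A < (ε : EReal)) {y z : X} (hy : y ∈ A) (hz : z ∈ A) : |f y - f z| < ε := by
  have key : ∀ y ∈ A, ∀ z ∈ A, f y - f z < ε := fun y hy z hz => by
    have h1 : (f y : EReal) ≤ ⨆ y ∈ A, (f y : EReal) := le_iSup₂ (f := fun y _ => (f y : EReal)) y hy
    have h2 : (⨅ y ∈ A, (f y : EReal)) ≤ f z := iInf₂_le (f := fun y _ => (f y : EReal)) z hz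
    have := (EReal.sub_le_sub h1 h2).trans_lt h
    rwa [← EReal.coe_sub, EReal.coe_lt_coe_iff] at this
  rw [abs_sub_lt_iff]
  exact ⟨key y hy z hz, key z hz y hy⟩

theorem Ties.mono {X : Type*} [MeasurableSpace X] {F E : Setoid X} {μ : Measure X} {f : X → ℝ}
    {ε ε' : ℝ} (h : Ties F E μ f ε) (hε : ε ≤ ε') : Ties F E μ f ε' := by
  obtain ⟨S, hS, hSF, hSμ, hosc⟩ := h
  exact ⟨S, hS, hSF, hSμ.trans (ENNReal.ofReal_le_ofReal hε), fun x hx =>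
    (hosc x hx).trans_le (EReal.coe_le_coe_iff.2 hε)⟩

/-! ### The implications between the conditions -/

section Equivalence

variable {X : Type*} [MeasurableSpace X] [StandardBorelSpace X] {μ : Measure X}
  {E F : Setoid X} {f g : X → ℝ}

/-- Two different values are separated by a rational, so countably many superlevel sets, each
F-invariant, suffice. -/
theorem ErgodicWithin.aeInvariant_hyperfiniteMean (h : ErgodicWithin F E μ) (hF : IsHyperfinite F)
    (hf : BoundedMeasurable f) : AEInvariant E μ (hyperfiniteMean F f) := by
  have hq : ∀ q : ℚ, AEInvariantSet E μ {x | (q : ℝ) < hyperfiniteMean F f x} := fun q =>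
    h _ (measurableSet_lt measurable_const (measurable_hyperfiniteMean hF hf)) fun x y hxy => by
      simp only [Set.mem_ofPred_eq]
      rw [hyperfiniteMean_congr_point hF f hxy]
  choose Z hZ hZ0 hZi using hq
  refine ⟨⋃ q, Z q, MeasurableSet.iUnion hZ, measure_iUnion_null hZ0, ?_⟩
  have key : ∀ x ∉ ⋃ q, Z q, ∀ y ∉ ⋃ q, Z q, E x y →
      hyperfiniteMean F f x ≤ hyperfiniteMean F f y := by
    intro x hx y hy hxy
    by_contra! hlt
    obtain ⟨q, hq1, hq2⟩ := exists_rat_btwn hlt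
    rw [Set.mem_iUnion] at hx hy
    push Not at hx hy
    exact hq1.not_gt ((hZi q x (hx q) y (hy q) hxy).1 hq2)
  exact fun x hx y hy hxy => le_antisymm (key x hx y hy hxy) (key y hy x hx (E.symm hxy))

theorem measurableSet_image_fst_of_finite {R : Set (X × X)} (hR : MeasurableSet R)
    (hfin : ∀ x, {y | (x, y) ∈ R}.Finite) : MeasurableSet (Prod.fst '' R) := by
  obtain ⟨C, hC, hCi, rfl⟩ := exists_iUnion_injOn_fst hR hfin
  rw [Set.image_iUnion]
  exact MeasurableSet.iUnion fun n => (hC n).image_of_measurable_injOn measurable_fst (hCi n)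

/-- Any finite Borel subrelation of a hyperfinite relation is the start of a witness. -/
theorem IsWitness.exists_isWitness_ge {Fn : ℕ → Setoid X} (hFn : IsWitness Fn F) {F₀ : Setoid X}
    (hF₀ : IsFiniteBorel F₀) (hF₀F : F₀ ≤ F) :
    ∃ Gn : ℕ → Setoid X, IsWitness Gn F ∧ ∀ n, F₀ ≤ Gn n := by
  -- These F₀-invariant sets increase to X because F₀-classes are finite.
  let Y : ℕ → Set X := fun n => {x | ∀ y, F₀ x y → Fn n x y}
  have hYm : ∀ n, MeasurableSet (Y n) := fun n => by
    have : Y n = (Prod.fst '' ({p : X × X | F₀ p.1 p.2} \ {p | Fn n p.1 p.2}))ᶜ := by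
      ext x
      simp [Y]
    rw [this]
    refine (measurableSet_image_fst_of_finite (hF₀.1.diff (hFn.1 n).1) fun x => ?_).compl
    exact (hF₀.2 x).subset fun y hy => hy.1
  have hYi : ∀ n x y, F₀ x y → x ∈ Y n → y ∈ Y n := fun n x y hxy hx z hyz =>
    (Fn n).trans ((Fn n).symm (hx y hxy)) (hx z (F₀.trans hxy hyz))
  have hYmono : Monotone Y := fun n m hnm x hx y hxy => hFn.2.1 hnm (hx y hxy)
  have hYex : ∀ x, ∃ n, x ∈ Y n := fun x => by
    have hex : ∀ y, ∃ n, F₀ x y → Fn n x y := fun y => by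
      by_cases hxy : F₀ x y
      · obtain ⟨n, hn⟩ := (hFn.2.2 x y).1 (hF₀F hxy)
        exact ⟨n, fun _ => hn⟩
      · exact ⟨0, fun h => absurd h hxy⟩
    choose N hN using hex
    refine ⟨(hF₀.2 x).toFinset.sup N, fun y hxy => ?_⟩
    exact hFn.2.1 (Finset.le_sup (f := N) (by simpa using hxy)) (hN y hxy)
  -- On `Y n` the relation `Fn n` contains F₀, so one may use `Fn n` there and F₀ elsewhere.
  let G : ℕ → Setoid X := fun n =>
    { r := fun x y => F₀ x y ∨ (x ∈ Y n ∧ y ∈ Y n ∧ Fn n x y)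
      iseqv :=
        { refl := fun x => Or.inl (F₀.refl x)
          symm := by
            rintro x y (h | ⟨hx, hy, h⟩)
            · exact Or.inl (F₀.symm h)
            · exact Or.inr ⟨hy, hx, (Fn n).symm h⟩
          trans := by
            rintro x y z (h | ⟨hx, hy, h⟩) (h' | ⟨hy', hz, h'⟩)
            · exact Or.inl (F₀.trans h h')
            · have hx := hYi n y x (F₀.symm h) hy'
              exact Or.inr ⟨hx, hz, (Fn n).trans (hx y h) h'⟩
            · exact Or.inr ⟨hx, hYi n y z h' hy, (Fn n).trans h (hy z h')⟩
            · exact Or.inr ⟨hx, hz, (Fn n).trans h h'⟩ } }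
  have hG : ∀ n x y, G n x y ↔ F₀ x y ∨ (x ∈ Y n ∧ y ∈ Y n ∧ Fn n x y) := fun _ _ _ => Iff.rfl
  refine ⟨G, ⟨fun n => ⟨?_, fun x => ?_⟩, ?_, fun x y => ⟨fun h => ?_, ?_⟩⟩, fun n x y h => Or.inl h⟩
  · exact hF₀.1.union ((measurable_fst (hYm n)).inter ((measurable_snd (hYm n)).inter (hFn.1 n).1))
  · refine ((hF₀.2 x).union ((hFn.1 n).2 x)).subset ?_
    rintro y (h | ⟨-, -, h⟩)
    · exact Or.inl h
    · exact Or.inr h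
  · rintro n m hnm x y (h | ⟨hx, hy, h⟩)
    · exact Or.inl h
    · exact Or.inr ⟨hYmono hnm hx, hYmono hnm hy, hFn.2.1 hnm h⟩
  · obtain ⟨n, hn⟩ := (hFn.2.2 x y).1 h
    obtain ⟨k, hk⟩ := hYex x
    obtain ⟨l, hl⟩ := hYex y
    have h1 : n ≤ max n (max k l) := le_max_left _ _
    have h2 : k ≤ max n (max k l) := (le_max_left _ _).trans (le_max_right _ _)
    have h3 : l ≤ max n (max k l) := (le_max_right _ _).trans (le_max_right _ _)
    exact ⟨max n (max k l), Or.inr ⟨hYmono h2 hk, hYmono h3 hl, hFn.2.1 h1 hn⟩⟩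
  · rintro ⟨n, h | ⟨-, -, h⟩⟩
    · exact hF₀F h
    · exact hFn.le n h

theorem cauchyWithin_of_forall_witness (hF : IsHyperfinite F)
    (h : ∀ Fn : ℕ → Setoid X, IsWitness Fn F → SeqCauchyWithin Fn E μ f) :
    CauchyWithin F E μ f := by
  intro ε hε F₀ hF₀ hF₀F
  obtain ⟨Fn, hFn⟩ := hF
  obtain ⟨Gn, hGn, hle⟩ := hFn.exists_isWitness_ge hF₀ hF₀F
  obtain ⟨n, hn⟩ := h Gn hGn ε hε
  exact ⟨Gn n, hGn.1 n, hle n, hGn.le n, hn⟩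

variable [IsFiniteMeasure μ]

/-- Tying is stable under small perturbations in `L¹`. -/
theorem Ties.of_integral_abs_sub_le {ε : ℝ} (h : Ties F E μ f ε) (hε : 0 < ε)
    (hF : IsFiniteBorel F) (hFμ : IsPreserving F μ) (hf : BoundedMeasurable f)
    (hg : BoundedMeasurable g) (hfg : ∫ x, |f x - g x| ∂μ ≤ ε ^ 2) : Ties F E μ g (7 * ε) := by
  obtain ⟨S, hS, hSF, hSμ, hosc⟩ := h
  have hd := hf.sub hg
  have hm := hd.finiteMean hF
  refine ⟨S ∩ {x | |finiteMean F (fun y => f y - g y) x| < ε},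
    hS.inter (measurableSet_lt hm.1.abs measurable_const), fun x y hxy => ?_, ?_, ?_⟩
  · refine and_congr (hSF x y hxy) ?_
    simp only [Set.mem_ofPred_eq]
    rw [finiteMean_congr_point hxy]
  · rw [Set.compl_inter]
    have h1 : {x | |finiteMean F (fun y => f y - g y) x| < ε}ᶜ =
        {x | ε ≤ |finiteMean F (fun y => f y - g y) x|} := by ext x; simp
    have h2 : (∫ x, |f x - g x| ∂μ) / ε ≤ ε := by
      rw [div_le_iff₀ hε, ← sq]
      exact hfg
    calc μ (Sᶜ ∪ {x | |finiteMean F (fun y => f y - g y) x| < ε}ᶜ)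
        ≤ ENNReal.ofReal ε + ENNReal.ofReal ε := by
          refine (measure_union_le _ _).trans (add_le_add hSμ ?_)
          rw [h1]
          exact (measure_le_abs_finiteMean hF hFμ hd hε).trans (ENNReal.ofReal_le_ofReal h2)
      _ = ENNReal.ofReal (ε + ε) := (ENNReal.ofReal_add hε.le hε.le).symm
      _ ≤ ENNReal.ofReal (7 * ε) := ENNReal.ofReal_le_ofReal (by linarith)
  · rintro x ⟨hxS, hx⟩
    -- Replacing f by g at x and at y costs ε each, and the tie of f costs ε. The oscillation is
    -- thus at most 6ε, strictly below 7ε.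
    refine osc_lt_of_abs_sub_le (c := finiteMean F g x) (δ := 3 * ε) ?_ (by linarith)
    rintro y ⟨⟨hyS, hy⟩, hxy⟩
    have h1 := abs_sub_lt_of_osc_lt (hosc x hxS) (y := y) (z := x) ⟨hyS, hxy⟩ ⟨hxS, E.refl x⟩
    simp only [Set.mem_ofPred_eq] at hx hy
    rw [finiteMean_sub (hF.2 x)] at hx
    rw [finiteMean_sub (hF.2 y)] at hy
    rw [abs_lt] at h1 hx hy
    rw [abs_le]
    constructor <;> linarith [h1.1, h1.2, hx.1, hx.2, hy.1, hy.2]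

theorem eq_zero_of_finiteMean_eq_zero {X : Type*} {F : Setoid X} {x : X}
    (hx : {y | F x y}.Finite) {f : X → ℝ} (hf : ∀ y, 0 ≤ f y) (h : finiteMean F f x = 0) :
    f x = 0 := by
  rw [finiteMean_eq_sum hx, div_eq_zero_iff, or_iff_left (card_class_pos hx).ne',
    Finset.sum_eq_zero_iff_of_nonneg fun y _ => hf y] at h
  exact h x (by simp)

theorem seqCauchyWithin_of_aeInvariant {Fn : ℕ → Setoid X} (hFn : IsWitness Fn F)
    (hFμ : IsPreserving F μ) (hf : BoundedMeasurable f)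
    (h : AEInvariant E μ (hyperfiniteMean F f)) : SeqCauchyWithin Fn E μ f := by
  intro ε hε
  have hF : IsHyperfinite F := ⟨Fn, hFn⟩
  obtain ⟨Z, hZ, hZ0, hZi⟩ := h
  have hmeas : TendstoInMeasure μ (fun n => finiteMean (Fn n) f) atTop (hyperfiniteMean F f) :=
    tendstoInMeasure_of_tendsto_ae
      (fun n => (hf.finiteMean (hFn.1 n)).1.aestronglyMeasurable)
      (hFn.ae_tendsto_hyperfiniteMean hFμ hf)
  have h1 := tendstoInMeasure_iff_dist.1 hmeas (ε / 4) (by positivity)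
  obtain ⟨n, hn⟩ := ((tendsto_order.1 h1).2 (ENNReal.ofReal ε) (ENNReal.ofReal_pos.2 hε)).exists
  have hZb := BoundedMeasurable.indicator_one hZ
  have hZnn : ∀ y, 0 ≤ Z.indicator (fun _ => (1 : ℝ)) y := fun y =>
    Set.indicator_nonneg (fun _ _ => zero_le_one) y
  have hZm := hZb.finiteMean (hFn.1 n)
  let s : Set X := {x | |finiteMean (Fn n) f x - hyperfiniteMean F f x| < ε / 4}
  -- These are the points whose `Fn n`-class misses Z: the saturation of Z is removed to keep the
  -- set invariant, and it is null because the mean of the indicator of Z has integral μ Z = 0.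
  let t : Set X := {x | finiteMean (Fn n) (Z.indicator fun _ => (1 : ℝ)) x = 0}
  have ht0 : μ tᶜ = 0 := by
    have hi : ∫ x, finiteMean (Fn n) (Z.indicator fun _ => (1 : ℝ)) x ∂μ = 0 := by
      rw [integral_finiteMean (hFn.1 n) (hFμ.mono (hFn.le n)) hZb, integral_indicator hZ]
      simp [Measure.real, hZ0]
    exact (integral_eq_zero_iff_of_nonneg_ae
      (ae_of_all _ fun x => finiteMean_nonneg ((hFn.1 n).2 x) hZnn) (hZm.integrable μ)).1 hi
  have hst : ∀ x, x ∈ t → x ∉ Z := fun x hx hxZ => by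
    have := eq_zero_of_finiteMean_eq_zero ((hFn.1 n).2 x) hZnn hx
    simp [hxZ] at this
  refine ⟨n, s ∩ t, MeasurableSet.inter ?_ ?_, fun x y hxy => ?_, ?_, ?_⟩
  · exact measurableSet_lt ((hf.finiteMean (hFn.1 n)).1.sub
      (measurable_hyperfiniteMean hF hf)).abs measurable_const
  · exact measurableSet_eq_fun hZm.1 measurable_const
  · refine and_congr ?_ ?_ <;> simp only [s, t, Set.mem_ofPred_eq]
    · rw [finiteMean_congr_point hxy, hyperfiniteMean_congr_point hF f (hFn.le n hxy)]
    · rw [finiteMean_congr_point hxy]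
  · rw [Set.compl_inter]
    refine (measure_union_le _ _).trans ?_
    rw [ht0, add_zero]
    refine le_of_eq_of_le ?_ hn.le
    congr 1
    ext x
    simp [s, Real.dist_eq]
  · rintro x ⟨hxs, hxt⟩
    refine osc_lt_of_abs_sub_le (c := hyperfiniteMean F f x) (δ := ε / 4) ?_ (by linarith)
    rintro y ⟨⟨hys, hyt⟩, hxy⟩
    rw [hZi x (hst x hxt) y (hst y hyt) hxy]
    exact hys.le

theorem exists_integral_abs_sub_le_of_dense {X : Type*} [MeasurableSpace X] {μ : Measure X}
    {S : Set (X →₁[μ] ℝ)} (hS : Dense S) {g : X → ℝ} (hg : Integrable g μ) {ε : ℝ} (hε : 0 < ε) :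
    ∃ u ∈ S, ∫ x, |u x - g x| ∂μ ≤ ε := by
  obtain ⟨u, hu, hdist⟩ := hS.exists_dist_lt (hg.toL1 g) hε
  refine ⟨u, hu, ?_⟩
  rw [dist_comm, dist_eq_norm, L1.norm_eq_integral_norm] at hdist
  refine le_of_eq_of_le (integral_congr_ae ?_) hdist.le
  filter_upwards [Lp.coeFn_sub u (hg.toL1 g), hg.coeFn_toL1] with x h1 h2
  rw [h1, Pi.sub_apply, h2, Real.norm_eq_abs]

/-- A family of functions that is dense in `L¹` has a sequence that is still dense in `L¹`. -/
theorem exists_dense_seq {D : Set (X → ℝ)}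
    (hD : Dense {g : X →₁[μ] ℝ | ∃ f ∈ D, g =ᵐ[μ] f}) :
    ∃ d : ℕ → X → ℝ, (∀ k, d k ∈ D) ∧
      ∀ g : X → ℝ, Integrable g μ → ∀ ε : ℝ, 0 < ε → ∃ k, ∫ x, |d k x - g x| ∂μ ≤ ε := by
  have : Fact ((1 : ENNReal) ≠ ⊤) := ⟨ENNReal.one_ne_top⟩
  obtain ⟨t, htD, htc, htd⟩ := hD.exists_countable_dense_subset
  obtain ⟨u, rfl⟩ := htc.exists_eq_range htd.nonempty
  choose d hdD hd using fun k => htD (Set.mem_range_self k)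
  refine ⟨d, hdD, fun g hg ε hε => ?_⟩
  obtain ⟨_, ⟨k, rfl⟩, hk⟩ := exists_integral_abs_sub_le_of_dense htd hg hε
  refine ⟨k, le_of_eq_of_le (integral_congr_ae ?_) hk⟩
  filter_upwards [hd k] with x hx
  rw [hx]

theorem isFiniteBorel_bot : IsFiniteBorel (⊥ : Setoid X) := by
  refine ⟨?_, fun x => ?_⟩
  · exact measurableSet_eq_fun measurable_fst measurable_snd
  · exact (Set.finite_singleton x).subset fun y hy => (hy : x = y).symm

theorem exists_seqCauchyWithin_of_cauchyWithin (hFμ : IsPreserving F μ) {D : Set (X → ℝ)}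
    (hDb : ∀ f ∈ D, BoundedMeasurable f) (hD : Dense {g : X →₁[μ] ℝ | ∃ f ∈ D, g =ᵐ[μ] f})
    (h : ∀ f ∈ D, CauchyWithin F E μ f) :
    ∃ Fn : ℕ → Setoid X, (∀ n, IsFiniteBorel (Fn n) ∧ Fn n ≤ F) ∧ Monotone Fn ∧
      ∀ f ∈ D, SeqCauchyWithin Fn E μ f := by
  obtain ⟨d, hdD, hd⟩ := exists_dense_seq hD
  have step : ∀ (n : ℕ) (p : {G : Setoid X // IsFiniteBorel G ∧ G ≤ F}),
      ∃ q : {G : Setoid X // IsFiniteBorel G ∧ G ≤ F}, p.1 ≤ q.1 ∧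
        Ties q.1 E μ (d (Nat.unpair n).1) (1 / (((Nat.unpair n).2 : ℝ) + 1)) := by
    rintro n ⟨G, hG, hGF⟩
    obtain ⟨G', hG', hGG', hG'F, ht⟩ := h _ (hdD (Nat.unpair n).1)
      (1 / (((Nat.unpair n).2 : ℝ) + 1)) (by positivity) G hG hGF
    exact ⟨⟨G', hG', hG'F⟩, hGG', ht⟩
  choose next hnext hties using step
  let p : ℕ → {G : Setoid X // IsFiniteBorel G ∧ G ≤ F} := fun n =>
    -- Step n decodes a pair (k, j) and ties `d k` up to 1/(j + 1), so every such demand is met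
    -- once.
    Nat.rec ⟨⊥, isFiniteBorel_bot, bot_le⟩ (fun n q => next n q) n
  have hp : ∀ n, p (n + 1) = next n (p n) := fun n => rfl
  refine ⟨fun n => (p n).1, fun n => (p n).2, monotone_nat_of_le_succ fun n => ?_,
    fun f hf ε hε => ?_⟩
  · rw [hp]
    exact hnext n (p n)
  · obtain ⟨k, hk⟩ := hd f ((hDb f hf).integrable μ) ((ε / 7) ^ 2) (by positivity)
    obtain ⟨j, hj⟩ := exists_nat_one_div_lt (show 0 < ε / 7 by positivity)
    have ht := hties (Nat.pair k j) (p (Nat.pair k j))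
    rw [Nat.unpair_pair, ← hp] at ht
    refine ⟨Nat.pair k j + 1, ?_⟩
    have := (ht.mono hj.le).of_integral_abs_sub_le (by positivity) (p (Nat.pair k j + 1)).2.1
      (hFμ.mono (p (Nat.pair k j + 1)).2.2) (hDb _ (hdD k)) (hDb f hf) hk
    rwa [mul_div_cancel₀ _ (by norm_num : (7 : ℝ) ≠ 0)] at this

/-- The hypothesis is the common weakening of conditions 5 and 6: the tying relations need not form
a sequence. -/
theorem ergodicWithin_of_forall_exists_ties (hFμ : IsPreserving F μ) {D : Set (X → ℝ)}
    (hDb : ∀ f ∈ D, BoundedMeasurable f) (hD : Dense {g : X →₁[μ] ℝ | ∃ f ∈ D, g =ᵐ[μ] f})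
    (h : ∀ f ∈ D, ∀ ε : ℝ, 0 < ε → ∃ G : Setoid X, IsFiniteBorel G ∧ G ≤ F ∧ Ties G E μ f ε) :
    ErgodicWithin F E μ := by
  intro A hA hAF
  obtain ⟨d, hdD, hd⟩ := exists_dense_seq hD
  have hb := BoundedMeasurable.indicator_one hA
  have hex : ∀ j : ℕ, ∃ S : Set X, μ Sᶜ ≤ ENNReal.ofReal ((1 / 2) ^ j) ∧
      ∀ x ∈ S, ∀ y ∈ S, E x y → (x ∈ A ↔ y ∈ A) := by
    intro j
    have hδ : (0 : ℝ) < (1 / 2) ^ j / 7 := by positivity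
    obtain ⟨k, hk⟩ := hd _ (hb.integrable μ) (((1 / 2) ^ j / 7) ^ 2) (by positivity)
    obtain ⟨G, hG, hGF, ht⟩ := h _ (hdD k) _ hδ
    have ht' := ht.of_integral_abs_sub_le hδ hG (hFμ.mono hGF) (hDb _ (hdD k)) hb hk
    rw [mul_div_cancel₀ _ (by norm_num : (7 : ℝ) ≠ 0)] at ht'
    obtain ⟨S, -, -, hSμ, hosc⟩ := ht'
    refine ⟨S, hSμ, fun x hx y hy hxy => ?_⟩
    have h1 := abs_sub_lt_of_osc_lt (hosc x hx) (y := x) (z := y) ⟨hx, E.refl x⟩ ⟨hy, hxy⟩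
    have hinv : ∀ y z, G y z →
        A.indicator (fun _ => (1 : ℝ)) y = A.indicator (fun _ => (1 : ℝ)) z := fun y z hyz =>
      hAF.indicator_eq 1 (hGF hyz)
    rw [finiteMean_of_invariant (hG.2 x) hinv, finiteMean_of_invariant (hG.2 y) hinv] at h1
    have h2 : ((1 : ℝ) / 2) ^ j ≤ 1 := pow_le_one₀ (by norm_num) (by norm_num)
    -- Two values in {0, 1} at distance less than 1 are equal.
    have h3 := h1.trans_le h2
    by_cases hxA : x ∈ A <;> by_cases hyA : y ∈ A <;> simp [hxA, hyA] at h3 ⊢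
  choose S hSμ hS using hex
  have hsum : ∑' j, μ (S j)ᶜ ≠ ⊤ := by
    refine ne_top_of_le_ne_top ?_ (ENNReal.tsum_le_tsum hSμ)
    rw [← ENNReal.ofReal_tsum_of_nonneg (fun j => by positivity) summable_geometric_two]
    exact ENNReal.ofReal_ne_top
  -- Borel–Cantelli: a point off Z lies in all but finitely many `S j`, so any two such points share
  -- one.
  obtain ⟨Z, hZs, hZ, hZ0⟩ := exists_measurable_superset_of_null (ae_eventually_notMem hsum)
  refine ⟨Z, hZ, hZ0, fun x hx y hy hxy => ?_⟩
  have key : ∀ x ∉ Z, ∀ᶠ j in atTop, x ∈ S j := fun x hx => by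
    have : x ∈ {x | ∀ᶠ j in atTop, x ∉ (S j)ᶜ} := by
      by_contra hcon
      exact hx (hZs hcon)
    simpa using this
  obtain ⟨j, hj1, hj2⟩ := ((key x hx).and (key y hy)).exists
  exact hS j x hj1 y hj2 hxy

end Equivalence

end RelErg

theorem mainTheorem10 {X : Type*} [MeasurableSpace X] [StandardBorelSpace X]
    (μ : Measure X) [IsFiniteMeasure μ]
    (E F : Setoid X) (hE : RelErg.IsBorel E) (hFE : F ≤ E)
    (hF : RelErg.IsHyperfinite F) (hFμ : RelErg.IsPreserving F μ)
    (D : Set (X → ℝ))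
    (hDmeas : ∀ f ∈ D, Measurable f)
    (hDbdd : ∀ f ∈ D, ∃ C : ℝ, ∀ x, |f x| ≤ C)
    (hDdense : Dense {g : X →₁[μ] ℝ | ∃ f ∈ D, g =ᵐ[μ] f}) :
    -- the hyperfinite mean is well defined almost everywhere, whatever the witness
    (∀ f ∈ D, ∀ Fn : ℕ → Setoid X, RelErg.IsWitness Fn F →
      ∀ᵐ x ∂μ, Tendsto (fun n => RelErg.finiteMean (Fn n) f x) atTop
        (𝓝 (RelErg.hyperfiniteMean F f x))) ∧
    List.TFAE [
      RelErg.ErgodicWithin F E μ,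
      ∀ f ∈ D, RelErg.AEInvariant E μ (RelErg.hyperfiniteMean F f),
      ∀ f ∈ D, ∀ Fn : ℕ → Setoid X, RelErg.IsWitness Fn F → RelErg.SeqCauchyWithin Fn E μ f,
      ∀ f ∈ D, RelErg.CauchyWithin F E μ f,
      ∀ f ∈ D, ∃ Fn : ℕ → Setoid X, RelErg.IsWitness Fn F ∧ RelErg.SeqCauchyWithin Fn E μ f,
      ∃ Fn : ℕ → Setoid X, (∀ n, RelErg.IsFiniteBorel (Fn n) ∧ Fn n ≤ F) ∧ Monotone Fn ∧
        ∀ f ∈ D, RelErg.SeqCauchyWithin Fn E μ f] := by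
  have hDb : ∀ f ∈ D, RelErg.BoundedMeasurable f := fun f hf => ⟨hDmeas f hf, hDbdd f hf⟩
  refine ⟨fun f hf Fn hFn => hFn.ae_tendsto_hyperfiniteMean hFμ (hDb f hf), ?_⟩
  tfae_have 1 → 2 := fun h f hf => h.aeInvariant_hyperfiniteMean hF (hDb f hf)
  tfae_have 2 → 3 := fun h f hf Fn hFn =>
    RelErg.seqCauchyWithin_of_aeInvariant hFn hFμ (hDb f hf) (h f hf)
  tfae_have 3 → 4 := fun h f hf => RelErg.cauchyWithin_of_forall_witness hF (h f hf)
  tfae_have 4 → 6 := RelErg.exists_seqCauchyWithin_of_cauchyWithin hFμ hDb hDdense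
  tfae_have 3 → 5 := fun h f hf => hF.imp fun Fn hFn => ⟨hFn, h f hf Fn hFn⟩
  tfae_have 5 → 1 := fun h =>
    RelErg.ergodicWithin_of_forall_exists_ties hFμ hDb hDdense fun f hf ε hε => by
      obtain ⟨Fn, hFn, hc⟩ := h f hf
      obtain ⟨n, hn⟩ := hc ε hε
      exact ⟨Fn n, hFn.1 n, hFn.le n, hn⟩
  tfae_have 6 → 1 := by
    rintro ⟨Fn, hFn, -, hc⟩
    refine RelErg.ergodicWithin_of_forall_exists_ties hFμ hDb hDdense fun f hf ε hε => ?_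
    obtain ⟨n, hn⟩ := hc f hf ε hε
    exact ⟨Fn n, (hFn n).1, (hFn n).2, hn⟩
  tfae_finish
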